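/- Let $K$ be a field of characteristic $0$, and let $V$ be a braided vector space of diagonal type with basis $x_1,x_2$ and braiding $c(x_i\otimes x_j)=q_{ij}\,x_j\otimes x_i$, where $q_{ij}\in K^\times$. Put $q=q_{11}$, $r=q_{12}q_{21}$, $s=q_{22}$. Let $\mathcal B(V)$ be the Nichols algebra of $V$, that is, the quotient of the tensor algebra $T(V)$ by the sum of all two-sided ideals which are generated by homogeneous elements of degree at least $2$ and are coideals for the braided comultiplication $\Delta$ of $T(V)$ with $\Delta(x_i)=x_i\otimes 1+1\otimes x_i$. Let $\chi$ be the bicharacter on $\mathbb Z^2$ with $\chi(\alpha_i,\alpha_j)=q_{ij}$ for the standard basis $\alpha_1,\alpha_2$, and let $\deg x_i=\alpha_i$. Order words in $x_1<x_2$ lexicographically, a proper prefix being smaller. A nonempty word $u$ is a Lyndon word if $u<vw$ for every decomposition $u=wv$ into nonempty words. For a Lyndon word $u$ define $[u]\in\mathcal B(V)$ by $[x_i]=x_i$ and $[u]=[w][v]-\chi(\deg w,\deg v)[v][w]$ if $u=wv$ is the decomposition of $u$ into two Lyndon words with $|w|$ minimal; put $[u^e]=[u]^e$ for $e\ge 1$.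 We call $[w]$ a root vector candidate if $w=v^e$ for a Lyndon word $v$, where $e=1$ or $e$ is the (finite) multiplicative order of $\chi(\deg v,\deg v)$. A root vector candidate $[w]$ is called a root vector if it is not a linear combination of elements $[v_n]^{m_n}\cdots[v_1]^{m_1}$ with $n\ge 0$, $m_i\ge 0$ and root vector candidates $[v_1],\dots,[v_n]$ such that $w<v_1<\cdots<v_n$. For $m\ge 0$ let $(m)_q=1+q+\cdots+q^{m-1}$, $(m)_q^!=\prod_{i=1}^m (i)_q$ and $b_m=\prod_{j=0}^{m-1}(1-q^jr)$. Let $\mathbb J\subseteq\mathbb N_0$ be the set defined recursively by: $j\in\mathbb J$ if and only if $q^{j(j-1)/2}(-r)^js=-1$ and $q^{j+n-1}r^2\ne 1$ for all $n\in\mathbb J$ with $n<j$. Let $k\ge l\ge 0$ be integers with $(k+l)_q^!\,b_{k+l}\ne 0$ and, if $k=l$, with $q^{k^2}r^ks=-1$. Then $[x_1^kx_2x_1^lx_2]$ is a root vector of $\mathcal B(V)$ if and only if $|\mathbb J\cap[0,k+l]|\le l$. -/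

import Mathlib

open scoped TensorProduct

noncomputable section

namespace RootVec

/-! ### Quantum integers and the set `J` -/

section Quantum

variable {K : Type*} [Field K]

/-- The quantum integer `(m)_q = 1 + q + ⋯ + q ^ (m - 1)`. -/
def qInt (q : K) (m : ℕ) : K := ∑ i ∈ Finset.range m, q ^ i

/-- The quantum factorial `(m)_q^! = (1)_q (2)_q ⋯ (m)_q`. -/
def qFactorial (q : K) (m : ℕ) : K := ∏ i ∈ Finset.range m, qInt q (i + 1)

/-- `b_m = ∏_{j=0}^{m-1} (1 - q ^ j r)`. -/
def bProd (q r : K) (m : ℕ) : K := ∏ j ∈ Finset.range m, (1 - q ^ j * r)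

/-- Membership in `J`, by recursion on `j`: `q ^ (j (j - 1) / 2) (-r) ^ j s = -1`, and
`q ^ (j + n - 1) r ^ 2 ≠ 1` for all members `n < j` of `J`. -/
def IsInJ (q r s : K) (j : ℕ) : Prop :=
  q ^ (j * (j - 1) / 2) * (-r) ^ j * s = -1 ∧
    ∀ n : ℕ, n < j → IsInJ q r s n → q ^ (j + n - 1) * r ^ 2 ≠ 1
termination_by j

/-- The set `J = J_{q,r,s} ⊆ ℕ`. -/
def setJ (q r s : K) : Set ℕ := {j | IsInJ q r s j}

theorem mem_setJ_iff (q r s : K) (j : ℕ) :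
    j ∈ setJ q r s ↔ q ^ (j * (j - 1) / 2) * (-r) ^ j * s = -1 ∧
      ∀ n ∈ setJ q r s, n < j → q ^ (j + n - 1) * r ^ 2 ≠ 1 := by
  constructor
  · intro h
    rw [setJ, Set.mem_ofPred_eq, IsInJ] at h
    exact ⟨h.1, fun n hn hj => h.2 n hj hn⟩
  · intro h
    rw [setJ, Set.mem_ofPred_eq, IsInJ]
    exact ⟨h.1, fun n hj hn => h.2 n hn hj⟩

end Quantum

/-! ### Words -/

section Words

variable {n : ℕ}

/-- Lyndon words over the alphabet `0 < 1 < ⋯ < n - 1`; the order on `List (Fin n)` is the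
lexicographic one, in which a proper prefix of a word is smaller than the word. -/
def IsLyndon (u : List (Fin n)) : Prop :=
  u ≠ [] ∧ ∀ w v : List (Fin n), u = w ++ v → w ≠ [] → v ≠ [] → u < v ++ w

/-- The length `|w|` of the left factor of the Shirshow decomposition `u = w v`: the least
possible length in a decomposition of `u` into two Lyndon words (and `0` if there is none). -/
def shirshowIndex (u : List (Fin n)) : ℕ :=
  sInf {i | 0 < i ∧ i < u.length ∧ IsLyndon (u.take i) ∧ IsLyndon (u.drop i)}

/-- The word `v ^ e`. -/
def wordPow (v : List (Fin n)) (e : ℕ) : List (Fin n) := (List.replicate e v).flatten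

/-- The degree of a word in `ℕ ^ n`. -/
def wordDeg (w : List (Fin n)) : Fin n → ℕ := fun i => w.count i

end Words

/-! ### The Nichols algebra of a braided vector space of diagonal type

`V` has basis `x_0, …, x_{n-1}` and braiding `c (x_i ⊗ x_j) = Q i j • x_j ⊗ x_i`.
Its tensor algebra is `FreeAlgebra K (Fin n)`, with `x_i = FreeAlgebra.ι K i`. -/

section Nichols

variable {K : Type*} [Field K] {n : ℕ}

/-- The bicharacter `χ` with `χ (α_i, α_j) = Q i j`, on `ℕ ^ n`. -/
def bichar (Q : Fin n → Fin n → K) (a b : Fin n → ℕ) : K :=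
  ∏ i, ∏ j, Q i j ^ (a i * b j)

/-- The monomial in the tensor algebra given by a word. -/
def monom (K : Type*) [Field K] (w : List (Fin n)) : FreeAlgebra K (Fin n) :=
  (w.map (FreeAlgebra.ι K)).prod

/-- The component `T^d(V)` of the tensor algebra, spanned by the words of length `d`. -/
def tensorPow (K : Type*) [Field K] (n d : ℕ) : Submodule K (FreeAlgebra K (Fin n)) :=
  Submodule.span K {x | ∃ w : List (Fin n), w.length = d ∧ x = monom K w}

/-- The algebra automorphism `y ↦ χ (α_i, deg y) y` of the tensor algebra, which describes
the braiding `c (x_i ⊗ y) = χ (α_i, deg y) y ⊗ x_i`. -/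
def twist (Q : Fin n → Fin n → K) (i : Fin n) :
    FreeAlgebra K (Fin n) →ₐ[K] FreeAlgebra K (Fin n) :=
  FreeAlgebra.lift K fun j => Q i j • FreeAlgebra.ι K j

/-- Left multiplication by `x_i ⊗ 1 + 1 ⊗ x_i` in the braided tensor square of the tensor
algebra: `(x_i ⊗ 1) (a ⊗ b) = x_i a ⊗ b` and
`(1 ⊗ x_i) (a ⊗ b) = χ (α_i, deg a) a ⊗ x_i b`. -/
def primMul (Q : Fin n → Fin n → K) (i : Fin n) :
    Module.End K (FreeAlgebra K (Fin n) ⊗[K] FreeAlgebra K (Fin n)) :=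
  TensorProduct.map (LinearMap.mulLeft K (FreeAlgebra.ι K i)) LinearMap.id +
    TensorProduct.map (twist Q i).toLinearMap (LinearMap.mulLeft K (FreeAlgebra.ι K i))

/-- The braided comultiplication `Δ` of the tensor algebra, that is, the algebra map to the
braided tensor square with `Δ (x_i) = x_i ⊗ 1 + 1 ⊗ x_i`. It is determined by `Δ 1 = 1 ⊗ 1` and
`Δ (x_i y) = (x_i ⊗ 1 + 1 ⊗ x_i) Δ y`. -/
def comul (Q : Fin n → Fin n → K) :
    FreeAlgebra K (Fin n) →ₗ[K] FreeAlgebra K (Fin n) ⊗[K] FreeAlgebra K (Fin n) :=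
  LinearMap.applyₗ (1 ⊗ₜ[K] 1) ∘ₗ (FreeAlgebra.lift K (primMul Q)).toLinearMap

/-- A two-sided ideal of the tensor algebra generated by homogeneous elements of degree at
least two (that is, the sum of its components of degree at least two), which is a coideal:
`Δ (I) ⊆ I ⊗ T(V) + T(V) ⊗ I`. -/
structure IsHomogeneousBiideal (Q : Fin n → Fin n → K) (I : Ideal (FreeAlgebra K (Fin n))) :
    Prop where
  isTwoSided : I.IsTwoSided
  homogeneous : I.restrictScalars K ≤ ⨆ d ≥ 2, I.restrictScalars K ⊓ tensorPow K n d
  coideal : ∀ x ∈ I, comul Q x ∈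
    LinearMap.range (TensorProduct.map (I.restrictScalars K).subtype
      (LinearMap.id : FreeAlgebra K (Fin n) →ₗ[K] FreeAlgebra K (Fin n))) ⊔
    LinearMap.range (TensorProduct.map
      (LinearMap.id : FreeAlgebra K (Fin n) →ₗ[K] FreeAlgebra K (Fin n))
      (I.restrictScalars K).subtype)

/-- The defining ideal of the Nichols algebra: the sum of all ideals as above. -/
def nicholsIdeal (Q : Fin n → Fin n → K) : Ideal (FreeAlgebra K (Fin n)) :=
  sSup {I | IsHomogeneousBiideal Q I}

instance nicholsIdeal_isTwoSided (Q : Fin n → Fin n → K) : (nicholsIdeal Q).IsTwoSided := by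
  refine ⟨fun {a} b ha => ?_⟩
  unfold nicholsIdeal at ha ⊢
  rw [sSup_eq_iSup'] at ha ⊢
  induction ha using Submodule.iSup_induction' with
  | mem I x hx =>
    have := I.2.isTwoSided
    exact (le_iSup (fun J : {I // IsHomogeneousBiideal Q I} => J.1) I)
      (Ideal.mul_mem_right b I.1 hx)
  | zero => simp
  | add x y _ _ hx hy => rw [add_mul]; exact add_mem hx hy

/-- The Nichols algebra `B(V)`. -/
abbrev NicholsAlgebra (Q : Fin n → Fin n → K) : Type _ :=
  FreeAlgebra K (Fin n) ⧸ nicholsIdeal Q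

/-- The canonical map `T(V) → B(V)`. -/
def toNichols (Q : Fin n → Fin n → K) : FreeAlgebra K (Fin n) →+* NicholsAlgebra Q :=
  Ideal.Quotient.mk (nicholsIdeal Q)

/-! ### Super-letters, root vector candidates and root vectors -/

/-- The super-letter `[u] ∈ B(V)` of a Lyndon word `u`: a letter `x_i` is mapped to itself, and
`[u] = [w] [v] - χ (deg w, deg v) [v] [w]` if `u = w v` is the Shirshow decomposition. -/
def superLetter (Q : Fin n → Fin n → K) (u : List (Fin n)) : NicholsAlgebra Q :=
  if _h : 0 < shirshowIndex u ∧ shirshowIndex u < u.length then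
    superLetter Q (u.take (shirshowIndex u)) * superLetter Q (u.drop (shirshowIndex u)) -
      bichar Q (wordDeg (u.take (shirshowIndex u))) (wordDeg (u.drop (shirshowIndex u))) •
        (superLetter Q (u.drop (shirshowIndex u)) * superLetter Q (u.take (shirshowIndex u)))
  else toNichols Q (monom K u)
termination_by u.length
decreasing_by all_goals (simp only [List.length_take, List.length_drop]; omega)

/-- The set `O_α \ {∞}`: it consists of `1` and, if the multiplicative order `o_α` of
`χ (α, α)` is finite, of `o_α` in characteristic zero and of all `o_α p ^ j` in characteristic
`p > 0`. (`orderOf` is zero for elements of infinite order; `ringExpChar K` is one in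
characteristic zero, and the characteristic otherwise.) -/
def finExponents (Q : Fin n → Fin n → K) (a : Fin n → ℕ) : Set ℕ :=
  {e | e = 1 ∨ (0 < orderOf (bichar Q a a) ∧
    ∃ j : ℕ, e = orderOf (bichar Q a a) * ringExpChar K ^ j)}

/-- A root vector candidate: a word `v ^ e` with `v` a Lyndon word and
`e ∈ O_{deg v} \ {∞}`. -/
structure Candidate (Q : Fin n → Fin n → K) where
  base : List (Fin n)
  exponent : ℕ
  isLyndon : IsLyndon base
  exponent_mem : exponent ∈ finExponents Q (wordDeg base)

/-- The word `w = v ^ e` of a root vector candidate `[w]`. -/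
def Candidate.word {Q : Fin n → Fin n → K} (c : Candidate Q) : List (Fin n) :=
  wordPow c.base c.exponent

/-- The element `[w] = [v] ^ e` of the Nichols algebra. -/
def Candidate.elt {Q : Fin n → Fin n → K} (c : Candidate Q) : NicholsAlgebra Q :=
  superLetter Q c.base ^ c.exponent

/-- The elements `[v_k] ^ {m_k} ⋯ [v_1] ^ {m_1}` of the Nichols algebra, where `k ≥ 0` and
`[v_1], …, [v_k]` are root vector candidates with `w < v_1 < ⋯ < v_k`. -/
def largerMonomials (Q : Fin n → Fin n → K) (w : List (Fin n)) : Set (NicholsAlgebra Q) :=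
  {a | ∃ L : List (Candidate Q × ℕ),
    (L.map fun p => p.1.word).Pairwise (fun u v => v < u) ∧
    (∀ p ∈ L, w < p.1.word) ∧
    a = (L.map fun p => p.1.elt ^ p.2).prod}

/-- `[w]` is a root vector: it is a root vector candidate, and it is not a linear combination
of monomials in larger root vector candidates. -/
def IsRootVector (Q : Fin n → Fin n → K) (w : List (Fin n)) : Prop :=
  ∃ c : Candidate Q, c.word = w ∧ c.elt ∉ Submodule.span K (largerMonomials Q w)

end Nichols

end RootVec

end

/-!
The defining ideal of the Nichols algebra is the radical of the pairing given by iterated skew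
derivations `∂_i` (`nicholsIdeal_eq_radical`): an element without constant term vanishes in
`B(V)` if and only if all of its skew derivatives do.

Write `u_j = (ad x_1)^j (x_2)`, `m = k + l` and `β_j = (j)_q (1 - q ^ (j - 1) r)`; the hypothesis
says that `β_1, …, β_m` are nonzero. The super-letter of `x_1 ^ j x_2` is `u_j`, and the
super-letter of `x_1 ^ k x_2 x_1 ^ l x_2` is the braided commutator of `u_k` and `u_l` up to
products `u_a u_b` with `a, b > l` (`exists_superLetter_twoWord`). These products span the
monomials of degree `m α_1 + 2 α_2` in larger root vector candidates
(`toNichols_mem_span_largerMonomials_iff`). Hence the word fails to give a root vector exactly if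
there is a relation `∑ c_a u_a u_{m - a} = 0` in `B(V)` with leading term at `u_k u_l`, that is,
with `c_k ≠ 0` and `c_a = 0` unless `l ≤ a ≤ k`
(`toNichols_quadSum_mem_midImage_iff`); the ratio of `c_k` and `c_l` is then forced.

On coefficient sequences, `∂_1` acts by a lowering operator `D` and `ad x_1` by a raising operator
`X`, where `D X - q X D` is a scalar in each degree. Since `∂_2 u_j = 0` for `j > 0`, a sequence
`c` is a relation if and only if `D c` is a relation and `c_0 + q_{12} ^ m s c_m = 0`
(`quadSum_mem_radical_iff`). In each degree `j` there is a unique singular vector `P_j`, with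
`D P_j = 0`, and it is a relation if and only if `q ^ (j (j - 1) / 2) (-r) ^ j s = -1`. The
second condition in the definition of `J` expresses that `P_j` is not obtained by raising `P_n`.
It follows that the `X ^ (m - j) P_j` with `j ∈ J` form a basis of the space of relations in
degree `m`, so this space has dimension `|J ∩ [0, m]|` (`relSpace_le_span_relGens_and_finrank`).
The delicate point is that no further relations arise in a degree `j ∉ J` satisfying the first
condition (`exists_lowerOp_eq_smul_iterate`). Finally, `X D` moves leading terms outwards, so the
leading terms form an initial segment: there is a relation with leading term at `u_k u_l` if and
only if `l` is less than the dimension (`hasLeading_iff`).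
-/

open scoped TensorProduct

noncomputable section

namespace RootVec

/-! ### Skew derivations of the tensor algebra -/

section Derivations

variable {K : Type*} [Field K] {n : ℕ} (Q : Fin n → Fin n → K)

@[simp] theorem monom_nil : monom K ([] : List (Fin n)) = 1 := rfl

theorem monom_cons (i : Fin n) (w : List (Fin n)) :
    monom K (i :: w) = FreeAlgebra.ι K i * monom K w := by simp [monom]

theorem monom_append (v w : List (Fin n)) : monom K (v ++ w) = monom K v * monom K w := by
  simp [monom]

theorem basisFreeMonoid_eq_monom (w : List (Fin n)) :
    FreeAlgebra.basisFreeMonoid K (Fin n) (FreeMonoid.ofList w) = monom K w := by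
  rw [FreeAlgebra.basisFreeMonoid]
  simp only [Module.Basis.map_apply, Finsupp.coe_basisSingleOne]
  rw [LinearEquiv.symm_apply_eq]
  induction w with
  | nil => simp; rfl
  | cons i w ih =>
    have h : FreeAlgebra.equivMonoidAlgebraFreeMonoid (monom K w) =
        MonoidAlgebra.single (FreeMonoid.ofList w) (1 : K) := by
      apply (MonoidAlgebra.coeffLinearEquiv K).injective
      simpa using ih.symm
    simp only [monom_cons, LinearEquiv.trans_apply, AlgEquiv.toLinearEquiv_apply, map_mul, h]
    simp [FreeAlgebra.equivMonoidAlgebraFreeMonoid, MonoidAlgebra.of_apply,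
      MonoidAlgebra.single_mul_single]

theorem span_monom : Submodule.span K (Set.range (monom K : List (Fin n) → _)) = ⊤ := by
  rw [← (FreeAlgebra.basisFreeMonoid K (Fin n)).span_eq]
  congr 1
  ext x
  constructor
  · rintro ⟨w, rfl⟩
    exact ⟨FreeMonoid.ofList w, basisFreeMonoid_eq_monom w⟩
  · rintro ⟨w, rfl⟩
    exact ⟨FreeMonoid.toList w, (basisFreeMonoid_eq_monom (FreeMonoid.toList w)).symm⟩

theorem ext_monom {M : Type*} [AddCommMonoid M] [Module K M] {f g : FreeAlgebra K (Fin n) →ₗ[K] M}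
    (h : ∀ w, f (monom K w) = g (monom K w)) : f = g := by
  apply LinearMap.ext_on span_monom
  rintro _ ⟨w, rfl⟩
  exact h w

/-- The algebra automorphism `y ↦ χ (deg y, α_i) y` of the tensor algebra. -/
def cotwist (i : Fin n) : FreeAlgebra K (Fin n) →ₐ[K] FreeAlgebra K (Fin n) :=
  FreeAlgebra.lift K fun j => Q j i • FreeAlgebra.ι K j

/-- The upper triangular matrix with diagonal `χ (deg y, α_i) y`, `y` and corner `∂_i y`;
multiplicativity in `y` expresses the skew Leibniz rule for `∂_i`. -/
def skewDerMatrix (i : Fin n) :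
    FreeAlgebra K (Fin n) →ₐ[K] Matrix (Fin 2) (Fin 2) (FreeAlgebra K (Fin n)) :=
  FreeAlgebra.lift K fun j =>
    !![Q j i • FreeAlgebra.ι K j, if i = j then 1 else 0; 0, FreeAlgebra.ι K j]

/-- The skew derivation `∂_i` of the tensor algebra, given by `∂_i x_j = δ_{ij}` and
`∂_i (a b) = ∂_i (a) b + χ (deg a, α_i) a ∂_i (b)`. The element `∂_i y` is the right tensor
factor of the component of `Δ y` with left tensor factor `x_i`. -/
def skewDer (i : Fin n) : FreeAlgebra K (Fin n) →ₗ[K] FreeAlgebra K (Fin n) where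
  toFun y := skewDerMatrix Q i y 0 1
  map_add' x y := by simp
  map_smul' c x := by simp

theorem skewDerMatrix_eq (i : Fin n) (y : FreeAlgebra K (Fin n)) :
    skewDerMatrix Q i y = !![cotwist Q i y, skewDer Q i y; 0, y] := by
  have hmul : ∀ a b : FreeAlgebra K (Fin n),
      skewDerMatrix Q i a = !![cotwist Q i a, skewDer Q i a; 0, a] →
      skewDerMatrix Q i b = !![cotwist Q i b, skewDer Q i b; 0, b] →
      skewDerMatrix Q i (a * b) = !![cotwist Q i (a * b), skewDer Q i (a * b); 0, a * b] := by
    intro a b ha hb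
    have h01 : skewDer Q i (a * b) = cotwist Q i a * skewDer Q i b + skewDer Q i a * b := by
      change skewDerMatrix Q i (a * b) 0 1 = _
      rw [map_mul, ha, hb]
      simp
    rw [h01, map_mul, ha, hb]
    simp
  induction y using FreeAlgebra.induction with
  | grade0 r =>
    have h01 : skewDer Q i (algebraMap K _ r) = 0 := by
      change skewDerMatrix Q i _ 0 1 = _
      simp [Matrix.algebraMap_matrix_apply]
    rw [h01]
    ext a b
    fin_cases a <;> fin_cases b <;> simp [Matrix.algebraMap_matrix_apply]
  | grade1 j =>
    have h01 : skewDer Q i (FreeAlgebra.ι K j) = if i = j then 1 else 0 := by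
      change skewDerMatrix Q i _ 0 1 = _
      simp [skewDerMatrix]
    rw [h01]
    simp [skewDerMatrix, cotwist]
  | mul a b ha hb => exact hmul a b ha hb
  | add a b ha hb =>
    rw [map_add, ha, hb]
    simp

theorem skewDer_mul (i : Fin n) (a b : FreeAlgebra K (Fin n)) :
    skewDer Q i (a * b) = skewDer Q i a * b + cotwist Q i a * skewDer Q i b := by
  change skewDerMatrix Q i (a * b) 0 1 = _
  rw [map_mul, skewDerMatrix_eq, skewDerMatrix_eq]
  simp [add_comm]

@[simp] theorem skewDer_one (i : Fin n) : skewDer Q i 1 = 0 := by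
  change skewDerMatrix Q i 1 0 1 = _
  simp

@[simp] theorem skewDer_ι (i j : Fin n) :
    skewDer Q i (FreeAlgebra.ι K j) = if i = j then 1 else 0 := by
  change skewDerMatrix Q i _ 0 1 = _
  simp [skewDerMatrix]

@[simp] theorem cotwist_ι (i j : Fin n) :
    cotwist Q i (FreeAlgebra.ι K j) = Q j i • FreeAlgebra.ι K j := by
  simp [cotwist]

@[simp] theorem twist_ι (i j : Fin n) :
    twist Q i (FreeAlgebra.ι K j) = Q i j • FreeAlgebra.ι K j := by
  simp [twist]

theorem skewDer_ι_mul (i j : Fin n) (y : FreeAlgebra K (Fin n)) :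
    skewDer Q i (FreeAlgebra.ι K j * y) =
      (if i = j then y else 0) + Q j i • (FreeAlgebra.ι K j * skewDer Q i y) := by
  rw [skewDer_mul]
  split_ifs with h <;> simp [h]

theorem skewDer_cotwist (i j : Fin n) (y : FreeAlgebra K (Fin n)) :
    skewDer Q j (cotwist Q i y) = Q j i • cotwist Q i (skewDer Q j y) := by
  have : skewDer Q j ∘ₗ (cotwist Q i).toLinearMap =
      Q j i • ((cotwist Q i).toLinearMap ∘ₗ skewDer Q j) := by
    refine ext_monom fun w => ?_
    induction w with
    | nil => simp
    | cons k w ih =>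
      simp only [LinearMap.comp_apply, AlgHom.toLinearMap_apply, LinearMap.smul_apply] at ih ⊢
      rw [monom_cons, map_mul, cotwist_ι, skewDer_ι_mul, smul_mul_assoc, map_smul, skewDer_ι_mul,
        ih]
      split_ifs with h
      · subst h; simp [smul_smul, mul_comm]
      · simp [smul_smul, mul_comm, mul_left_comm]
  exact LinearMap.congr_fun this y

theorem skewDer_twist (i j : Fin n) (y : FreeAlgebra K (Fin n)) :
    skewDer Q j (twist Q i y) = Q i j • twist Q i (skewDer Q j y) := by
  have : skewDer Q j ∘ₗ (twist Q i).toLinearMap =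
      Q i j • ((twist Q i).toLinearMap ∘ₗ skewDer Q j) := by
    refine ext_monom fun w => ?_
    induction w with
    | nil => simp
    | cons k w ih =>
      simp only [LinearMap.comp_apply, AlgHom.toLinearMap_apply, LinearMap.smul_apply] at ih ⊢
      rw [monom_cons, map_mul, twist_ι, skewDer_ι_mul, smul_mul_assoc, map_smul, skewDer_ι_mul,
        ih]
      split_ifs with h
      · subst h; simp [smul_smul, mul_comm]
      · simp [smul_smul, mul_comm, mul_left_comm]
  exact LinearMap.congr_fun this y

/-- The counit of the tensor algebra. -/
abbrev counit (K : Type*) [Field K] (n : ℕ) : FreeAlgebra K (Fin n) →ₐ[K] K :=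
  FreeAlgebra.algebraMapInv

@[simp] theorem counit_ι (i : Fin n) : counit K n (FreeAlgebra.ι K i) = 0 := by
  simp [FreeAlgebra.algebraMapInv]

/-- The functional `y ↦ ε (∂_{i_d} ⋯ ∂_{i_1} y)` for the word `w = i_1 ⋯ i_d`. -/
def pairing : List (Fin n) → FreeAlgebra K (Fin n) →ₗ[K] K
  | [] => (counit K n).toLinearMap
  | i :: w => pairing w ∘ₗ skewDer Q i

@[simp] theorem pairing_nil (y : FreeAlgebra K (Fin n)) : pairing Q [] y = counit K n y := rfl

@[simp] theorem pairing_cons (i : Fin n) (w : List (Fin n)) (y : FreeAlgebra K (Fin n)) :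
    pairing Q (i :: w) y = pairing Q w (skewDer Q i y) := rfl

theorem pairing_cotwist (i : Fin n) (w : List (Fin n)) (y : FreeAlgebra K (Fin n))
    (hy : ∀ w, pairing Q w y = 0) : pairing Q w (cotwist Q i y) = 0 := by
  induction w generalizing y with
  | nil =>
    have : (counit K n).comp (cotwist Q i) = counit K n := by
      ext j
      simp
    have h := AlgHom.congr_fun this y
    simp only [AlgHom.comp_apply] at h
    rw [pairing_nil, h]
    exact hy []
  | cons j w ih =>
    rw [pairing_cons, skewDer_cotwist, map_smul, ih _ (fun w => hy (j :: w)), smul_zero]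

theorem pairing_mul_left (w : List (Fin n)) (a b : FreeAlgebra K (Fin n))
    (hb : ∀ w, pairing Q w b = 0) : pairing Q w (a * b) = 0 := by
  induction w generalizing a b with
  | nil =>
    rw [pairing_nil, map_mul, show counit K n b = 0 from hb [], mul_zero]
  | cons i w ih =>
    rw [pairing_cons, skewDer_mul, map_add, ih _ _ hb, ih _ _ (fun w => hb (i :: w)), add_zero]

theorem pairing_mul_right (w : List (Fin n)) (a b : FreeAlgebra K (Fin n))
    (ha : ∀ w, pairing Q w a = 0) : pairing Q w (a * b) = 0 := by
  induction w generalizing a b with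
  | nil =>
    rw [pairing_nil, map_mul, show counit K n a = 0 from ha [], zero_mul]
  | cons i w ih =>
    rw [pairing_cons, skewDer_mul, map_add, ih _ _ (fun w => ha (i :: w)),
      ih _ _ (fun w => pairing_cotwist Q i w a ha), add_zero]

/-- The ideal of all elements of the tensor algebra whose iterated skew derivatives have
constant term zero. -/
def radical : Ideal (FreeAlgebra K (Fin n)) where
  carrier := {y | ∀ w, pairing Q w y = 0}
  add_mem' ha hb w := by rw [map_add, ha w, hb w, add_zero]
  zero_mem' w := map_zero _
  smul_mem' a b hb w := pairing_mul_left Q w a b hb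

variable {Q}

theorem mem_radical_iff {y : FreeAlgebra K (Fin n)} :
    y ∈ radical Q ↔ counit K n y = 0 ∧ ∀ i, skewDer Q i y ∈ radical Q := by
  constructor
  · exact fun h => ⟨h [], fun i w => h (i :: w)⟩
  · rintro ⟨h0, h1⟩ w
    cases w with
    | nil => exact h0
    | cons i w => exact h1 i w

variable (Q)

/-! ### The braided comultiplication and the skew derivations -/

theorem comul_ι_mul (i : Fin n) (y : FreeAlgebra K (Fin n)) :
    comul Q (FreeAlgebra.ι K i * y) = primMul Q i (comul Q y) := by
  simp [comul]

@[simp] theorem comul_one : comul Q 1 = 1 ⊗ₜ[K] 1 := by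
  simp [comul]

theorem skewDer_rTensor_primMul (i j : Fin n)
    (z : FreeAlgebra K (Fin n) ⊗[K] FreeAlgebra K (Fin n)) :
    (skewDer Q i).rTensor _ (primMul Q j z) =
      (if i = j then z else 0) + Q j i • primMul Q j ((skewDer Q i).rTensor _ z) := by
  induction z with
  | zero => simp
  | add a b ha hb =>
    simp only [map_add, ha, hb, smul_add]
    split_ifs <;> abel_nf
  | tmul a b =>
    simp only [primMul, LinearMap.add_apply, TensorProduct.map_tmul, map_add,
      LinearMap.rTensor_tmul, LinearMap.mulLeft_apply, LinearMap.id_apply, skewDer_ι_mul,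
      AlgHom.toLinearMap_apply, skewDer_twist, TensorProduct.add_tmul, TensorProduct.smul_tmul',
      smul_add]
    split_ifs <;> simp [add_assoc]

theorem skewDer_rTensor_comul (i : Fin n) (y : FreeAlgebra K (Fin n)) :
    (skewDer Q i).rTensor _ (comul Q y) = comul Q (skewDer Q i y) := by
  have : (skewDer Q i).rTensor _ ∘ₗ comul Q = comul Q ∘ₗ skewDer Q i := by
    refine ext_monom fun w => ?_
    induction w with
    | nil => simp
    | cons j w ih =>
      simp only [LinearMap.comp_apply] at ih ⊢
      rw [monom_cons, comul_ι_mul, skewDer_rTensor_primMul, ih, skewDer_ι_mul, map_add, map_smul,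
        comul_ι_mul]
      split_ifs <;> simp
  exact LinearMap.congr_fun this y

theorem counit_rTensor_comul (y : FreeAlgebra K (Fin n)) :
    TensorProduct.lid K _ ((counit K n).toLinearMap.rTensor _ (comul Q y)) = y := by
  have hprim : ∀ i (z : FreeAlgebra K (Fin n) ⊗[K] FreeAlgebra K (Fin n)),
      TensorProduct.lid K _ ((counit K n).toLinearMap.rTensor _ (primMul Q i z)) =
      FreeAlgebra.ι K i * TensorProduct.lid K _ ((counit K n).toLinearMap.rTensor _ z) := by
    intro i z
    have htw : ∀ a, counit K n (twist Q i a) = counit K n a := by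
      intro a
      have : (counit K n).comp (twist Q i) = counit K n := by
        ext j
        simp
      exact AlgHom.congr_fun this a
    induction z with
    | zero => simp
    | add a b ha hb => simp only [map_add, ha, hb, mul_add]
    | tmul a b => simp [primMul, htw]
  have : (TensorProduct.lid K _).toLinearMap ∘ₗ (counit K n).toLinearMap.rTensor _ ∘ₗ comul Q =
      LinearMap.id := by
    refine ext_monom fun w => ?_
    induction w with
    | nil => simp
    | cons j w ih =>
      simp only [LinearMap.comp_apply, LinearEquiv.coe_coe, LinearMap.id_apply] at ih ⊢
      rw [monom_cons, comul_ι_mul, hprim, ih]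
  exact LinearMap.congr_fun this y

/-- The functional `pairing Q w`, applied to the left tensor factor of `Δ y`, gives the iterated
skew derivative of `y` along `w`. -/
theorem pairing_rTensor_comul (w : List (Fin n)) (y : FreeAlgebra K (Fin n)) :
    TensorProduct.lid K _ ((pairing Q w).rTensor _ (comul Q y)) =
      w.foldl (fun z i => skewDer Q i z) y := by
  induction w generalizing y with
  | nil => exact counit_rTensor_comul Q y
  | cons i w ih =>
    rw [pairing, LinearMap.rTensor_comp, LinearMap.comp_apply, skewDer_rTensor_comul, ih]
    rfl

end Derivations

/-! ### Homogeneous components -/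

section Homogeneous

variable {K : Type*} [Field K] {n : ℕ} (Q : Fin n → Fin n → K)

theorem wordDeg_append (v w : List (Fin n)) : wordDeg (v ++ w) = wordDeg v + wordDeg w := by
  ext i
  simp [wordDeg]

theorem wordDeg_eq_iff_perm {v w : List (Fin n)} : wordDeg v = wordDeg w ↔ v.Perm w := by
  rw [List.perm_iff_count]
  exact ⟨fun h i => congrFun h i, fun h => funext h⟩

theorem sum_wordDeg (w : List (Fin n)) : ∑ i, wordDeg w i = w.length := by
  induction w with
  | nil => simp [wordDeg]
  | cons j w ih =>
    simp only [wordDeg] at ih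
    simp [wordDeg, List.count_cons, Finset.sum_add_distrib, ih]

open Classical in
/-- The projection of the tensor algebra onto the sum of the components whose degree in `ℕ ^ n`
satisfies `p`. -/
def degProj (K : Type*) [Field K] (p : (Fin n → ℕ) → Prop) :
    FreeAlgebra K (Fin n) →ₗ[K] FreeAlgebra K (Fin n) :=
  (FreeAlgebra.basisFreeMonoid K (Fin n)).constr K fun w =>
    if p (wordDeg (FreeMonoid.toList w)) then monom K (FreeMonoid.toList w) else 0

open Classical in
theorem degProj_monom (p : (Fin n → ℕ) → Prop) (w : List (Fin n)) :
    degProj K p (monom K w) = if p (wordDeg w) then monom K w else 0 := by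
  rw [degProj, ← basisFreeMonoid_eq_monom, Module.Basis.constr_basis, basisFreeMonoid_eq_monom,
    FreeMonoid.toList_ofList]

theorem skewDer_monom_mem (i : Fin n) (v : List (Fin n)) :
    skewDer Q i (monom K v) ∈
      Submodule.span K {y | ∃ w : List (Fin n), (i :: w).Perm v ∧ y = monom K w} := by
  induction v with
  | nil => simp
  | cons j v ih =>
    rw [monom_cons, skewDer_ι_mul]
    refine add_mem ?_ (Submodule.smul_mem _ _ ?_)
    · split_ifs with h
      · exact Submodule.subset_span ⟨v, by rw [h], rfl⟩
      · exact zero_mem _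
    · have h := Submodule.mem_map_of_mem (f := LinearMap.mulLeft K (FreeAlgebra.ι K j)) ih
      rw [Submodule.map_span] at h
      refine Submodule.span_mono ?_ h
      rintro _ ⟨_, ⟨w, hw, rfl⟩, rfl⟩
      exact ⟨j :: w, (List.Perm.swap j i w).trans (hw.cons j), by rw [monom_cons]; rfl⟩

theorem pairing_monom_of_not_perm (w v : List (Fin n)) (h : ¬ w.Perm v) :
    pairing Q w (monom K v) = 0 := by
  induction w generalizing v with
  | nil =>
    cases v with
    | nil => simp at h
    | cons j v => simp [monom_cons]
  | cons i w ih =>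
    have hle : Submodule.span K {y | ∃ w : List (Fin n), (i :: w).Perm v ∧ y = monom K w} ≤
        LinearMap.ker (pairing Q w) := by
      rw [Submodule.span_le]
      rintro _ ⟨w', hw', rfl⟩
      exact ih w' fun hp => h ((hp.cons i).trans hw')
    exact hle (skewDer_monom_mem Q i v)

open Classical in
theorem pairing_degProj (p : (Fin n → ℕ) → Prop) (w : List (Fin n))
    (y : FreeAlgebra K (Fin n)) :
    pairing Q w (degProj K p y) = if p (wordDeg w) then pairing Q w y else 0 := by
  have : pairing Q w ∘ₗ degProj K p = (if p (wordDeg w) then (1 : K) else 0) • pairing Q w := by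
    refine ext_monom fun v => ?_
    simp only [LinearMap.comp_apply, degProj_monom, LinearMap.smul_apply]
    by_cases hp : w.Perm v
    · rw [wordDeg_eq_iff_perm.2 hp]
      split_ifs <;> simp
    · rw [pairing_monom_of_not_perm Q w v hp]
      split_ifs <;> simp [pairing_monom_of_not_perm Q w v hp]
  have h := LinearMap.congr_fun this y
  simp only [LinearMap.comp_apply, LinearMap.smul_apply] at h
  rw [h]
  split_ifs <;> simp

variable {Q} in
theorem degProj_mem_radical (p : (Fin n → ℕ) → Prop) {y : FreeAlgebra K (Fin n)}
    (hy : y ∈ radical Q) : degProj K p y ∈ radical Q := by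
  intro w
  rw [pairing_degProj, hy w]
  simp

theorem degProj_length_mem (d : ℕ) (y : FreeAlgebra K (Fin n)) :
    degProj K (fun a => ∑ i, a i = d) y ∈ tensorPow K n d := by
  have hy : y ∈ Submodule.span K (Set.range (monom K : List (Fin n) → _)) := by
    rw [span_monom]; trivial
  induction hy using Submodule.span_induction with
  | mem x hx =>
    obtain ⟨w, rfl⟩ := hx
    rw [degProj_monom, sum_wordDeg]
    split_ifs with h
    · exact Submodule.subset_span ⟨w, h, rfl⟩
    · exact zero_mem _
  | zero => simp
  | add x y _ _ hx hy => rw [map_add]; exact add_mem hx hy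
  | smul c x _ hx => rw [map_smul]; exact Submodule.smul_mem _ _ hx

theorem exists_sum_degProj (y : FreeAlgebra K (Fin n)) :
    ∃ D, ∀ D' ≥ D, y = ∑ d ∈ Finset.range D', degProj K (fun a => ∑ i, a i = d) y := by
  have hy : y ∈ Submodule.span K (Set.range (monom K : List (Fin n) → _)) := by
    rw [span_monom]; trivial
  induction hy using Submodule.span_induction with
  | mem x hx =>
    obtain ⟨w, rfl⟩ := hx
    refine ⟨w.length + 1, fun D' hD => ?_⟩
    simp only [degProj_monom, sum_wordDeg]
    rw [Finset.sum_ite_eq, if_pos (Finset.mem_range.2 hD)]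
  | zero => exact ⟨0, fun _ _ => by simp⟩
  | add x y _ _ hx hy =>
    obtain ⟨D₁, h₁⟩ := hx
    obtain ⟨D₂, h₂⟩ := hy
    refine ⟨max D₁ D₂, fun D' hD => ?_⟩
    simp only [map_add, Finset.sum_add_distrib]
    rw [← h₁ D' (le_trans (le_max_left _ _) hD), ← h₂ D' (le_trans (le_max_right _ _) hD)]
  | smul c x _ hx =>
    obtain ⟨D, h⟩ := hx
    refine ⟨D, fun D' hD => ?_⟩
    simp only [map_smul, ← Finset.smul_sum]
    rw [← h D' hD]

/-- The component of degree `a ∈ ℕ ^ n` of the tensor algebra. -/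
def homog (K : Type*) [Field K] (a : Fin n → ℕ) : Submodule K (FreeAlgebra K (Fin n)) :=
  Submodule.span K {y | ∃ w : List (Fin n), wordDeg w = a ∧ y = monom K w}

theorem monom_mem_homog (w : List (Fin n)) : monom K w ∈ homog K (wordDeg w) :=
  Submodule.subset_span ⟨w, rfl, rfl⟩

theorem mul_mem_homog {a b : Fin n → ℕ} {x y : FreeAlgebra K (Fin n)} (hx : x ∈ homog K a)
    (hy : y ∈ homog K b) : x * y ∈ homog K (a + b) := by
  have h := Submodule.mul_mem_mul hx hy
  rw [homog, homog, Submodule.span_mul_span] at h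
  refine Submodule.span_mono ?_ h
  rintro _ ⟨_, ⟨v, hv, rfl⟩, _, ⟨w, hw, rfl⟩, rfl⟩
  exact ⟨v ++ w, by rw [wordDeg_append, hv, hw], by rw [monom_append]⟩

theorem degProj_of_mem_homog {a : Fin n → ℕ} {y : FreeAlgebra K (Fin n)} (hy : y ∈ homog K a) :
    degProj K (· = a) y = y := by
  induction hy using Submodule.span_induction with
  | mem x hx =>
    obtain ⟨w, hw, rfl⟩ := hx
    simp [degProj_monom, hw]
  | zero => simp
  | add x y _ _ hx hy => rw [map_add, hx, hy]
  | smul c x _ hx => rw [map_smul, hx]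

theorem degProj_of_mem_homog_of_ne {a b : Fin n → ℕ} (hab : b ≠ a)
    {y : FreeAlgebra K (Fin n)} (hy : y ∈ homog K b) : degProj K (· = a) y = 0 := by
  induction hy using Submodule.span_induction with
  | mem x hx =>
    obtain ⟨w, hw, rfl⟩ := hx
    simp [degProj_monom, hw, hab]
  | zero => simp
  | add x y _ _ hx hy => rw [map_add, hx, hy, add_zero]
  | smul c x _ hx => rw [map_smul, hx, smul_zero]

end Homogeneous

/-! ### The defining ideal of the Nichols algebra as a radical -/

section Radical

variable {K : Type*} [Field K] {n : ℕ} (Q : Fin n → Fin n → K)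

instance radical_isTwoSided : (radical Q).IsTwoSided :=
  ⟨fun {a} b ha w => pairing_mul_right Q w a b ha⟩

theorem eq_zero_of_mem_radical_of_mem_tensorPow {d : ℕ} (hd : d < 2)
    {y : FreeAlgebra K (Fin n)} (hy : y ∈ radical Q) (hyd : y ∈ tensorPow K n d) : y = 0 := by
  interval_cases d
  · have h : ∀ z ∈ tensorPow K n 0, z = algebraMap K _ (counit K n z) := by
      intro z hz
      induction hz using Submodule.span_induction with
      | mem x hx =>
        obtain ⟨w, hw, rfl⟩ := hx
        rw [List.length_eq_zero_iff] at hw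
        simp [hw]
      | zero => simp
      | add x y _ _ hx hy => rw [map_add, map_add, ← hx, ← hy]
      | smul c x _ hx =>
        rw [map_smul, smul_eq_mul, map_mul, ← hx, Algebra.smul_def]
    rw [h y hyd, show counit K n y = 0 from hy [], map_zero]
  · have h : ∀ z ∈ tensorPow K n 1, z = ∑ i, pairing Q [i] z • FreeAlgebra.ι K i := by
      intro z hz
      induction hz using Submodule.span_induction with
      | mem x hx =>
        obtain ⟨w, hw, rfl⟩ := hx
        obtain ⟨j, rfl⟩ := List.length_eq_one_iff.1 hw
        simp only [monom, List.map_cons, List.map_nil, List.prod_cons, List.prod_nil, mul_one,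
          pairing_cons, pairing_nil, skewDer_ι]
        rw [Finset.sum_eq_single j]
        · simp
        · intro b _ hb
          simp [hb]
        · simp
      | zero => simp
      | add x y _ _ hx hy =>
        simp only [map_add, add_smul, Finset.sum_add_distrib]
        rw [← hx, ← hy]
      | smul c x _ hx =>
        simp only [map_smul, smul_assoc, ← Finset.smul_sum]
        rw [← hx]
    rw [h y hyd]
    exact Finset.sum_eq_zero fun i _ => by rw [hy [i], zero_smul]

theorem tmul_mem_of_pairing_eq_zero {M : Type*} [AddCommGroup M] [Module K M]
    (z : FreeAlgebra K (Fin n) ⊗[K] M) (hz : ∀ w, (pairing Q w).rTensor M z = 0) :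
    ((radical Q).restrictScalars K).mkQ.rTensor M z = 0 := by
  let b := Module.Free.chooseBasis K M
  apply (TensorProduct.equivFinsuppOfBasisRight b).injective
  ext i
  rw [map_zero, Finsupp.zero_apply]
  have key : ∀ {N N' : Type _} [AddCommGroup N] [Module K N] [AddCommGroup N'] [Module K N']
      (f : N →ₗ[K] N') (x : N ⊗[K] M),
      TensorProduct.equivFinsuppOfBasisRight b (f.rTensor M x) i =
        f (TensorProduct.equivFinsuppOfBasisRight b x i) := by
    intro N N' _ _ _ _ f x
    induction x with
    | zero => simp
    | add x y hx hy => simp only [map_add, Finsupp.add_apply, hx, hy]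
    | tmul x y => simp
  rw [key, Submodule.mkQ_apply, Submodule.Quotient.mk_eq_zero]
  intro w
  rw [← key, hz w]
  simp

/-- For the coideal property: a tensor in `T(V) ⊗ M` is zero in `T(V)/radical ⊗ M` as soon as all
functionals `pairing Q w` kill it on the left, and these send `Δ y` to derivatives of `y`. -/
theorem radical_isHomogeneousBiideal : IsHomogeneousBiideal Q (radical Q) where
  isTwoSided := inferInstance
  homogeneous := by
    intro y hy
    obtain ⟨D, hD⟩ := exists_sum_degProj y
    rw [hD D le_rfl]
    refine sum_mem fun d _ => ?_
    have hr : degProj K (fun a => ∑ i, a i = d) y ∈ radical Q := degProj_mem_radical _ hy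
    rcases lt_or_ge d 2 with h | h
    · rw [eq_zero_of_mem_radical_of_mem_tensorPow Q h hr (degProj_length_mem d y)]
      exact zero_mem _
    · exact (le_iSup₂ (f := fun d (_ : d ≥ 2) =>
        (radical Q).restrictScalars K ⊓ tensorPow K n d) d h) ⟨hr, degProj_length_mem d y⟩
  coideal := by
    intro y hy
    set N := (radical Q).restrictScalars K with hN
    have hker := TensorProduct.map_ker (R := K) (g := N.mkQ) (g' := N.mkQ) (f := N.subtype)
      (f' := N.subtype) (by rw [LinearMap.exact_iff]; simp) N.mkQ_surjective
      (by rw [LinearMap.exact_iff]; simp) N.mkQ_surjective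
    have hmem : comul Q y ∈ LinearMap.ker (TensorProduct.map N.mkQ N.mkQ) := by
      rw [LinearMap.mem_ker, ← LinearMap.rTensor_comp_lTensor, LinearMap.comp_apply]
      apply tmul_mem_of_pairing_eq_zero
      intro w
      rw [← LinearMap.comp_apply, LinearMap.rTensor_comp_lTensor,
        ← LinearMap.lTensor_comp_rTensor, LinearMap.comp_apply]
      apply (TensorProduct.lid K _).injective
      have hl : ∀ x, TensorProduct.lid K _ (N.mkQ.lTensor K x) =
          N.mkQ (TensorProduct.lid K _ x) := by
        intro x
        induction x with
        | zero => simp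
        | add x y hx hy => simp only [map_add, hx, hy]
        | tmul x y => simp
      rw [hl, pairing_rTensor_comul, map_zero, Submodule.mkQ_apply,
        Submodule.Quotient.mk_eq_zero]
      have hfold : ∀ (w : List (Fin n)) (z : FreeAlgebra K (Fin n)), z ∈ radical Q →
          w.foldl (fun z i => skewDer Q i z) z ∈ radical Q := by
        intro w
        induction w with
        | nil => exact fun z hz => hz
        | cons i w ih => exact fun z hz => ih _ fun w => hz (i :: w)
      exact hfold w y hy
    rw [hker] at hmem
    rw [sup_comm]
    exact hmem

/-- A homogeneous biideal is stable under the skew derivations, and it has no constant terms. -/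
theorem IsHomogeneousBiideal.le_radical {I : Ideal (FreeAlgebra K (Fin n))}
    (hI : IsHomogeneousBiideal Q I) : I ≤ radical Q := by
  have hlow : ∀ w : List (Fin n), w.length < 2 → ∀ y ∈ I, pairing Q w y = 0 := by
    intro w hw y hy
    have hle : ⨆ d ≥ 2, I.restrictScalars K ⊓ tensorPow K n d ≤ LinearMap.ker (pairing Q w) := by
      refine iSup₂_le fun d hd => inf_le_right.trans ?_
      rw [tensorPow, Submodule.span_le]
      rintro _ ⟨v, hv, rfl⟩
      refine pairing_monom_of_not_perm Q w v fun hp => ?_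
      have := hp.length_eq
      omega
    exact hle (hI.homogeneous hy)
  have hstable : ∀ i, ∀ y ∈ I, skewDer Q i y ∈ I := by
    intro i y hy
    have h := pairing_rTensor_comul Q [i] y
    rw [List.foldl_cons, List.foldl_nil] at h
    rw [← h]
    obtain ⟨a, ha, b, hb, hab⟩ := Submodule.mem_sup.1 (hI.coideal y hy)
    rw [← hab, map_add, map_add]
    clear hab
    refine add_mem ?_ ?_
    · obtain ⟨z, rfl⟩ := ha
      convert I.zero_mem
      induction z with
      | zero => simp
      | add z z' hz hz' => simp only [map_add, hz, hz', add_zero]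
      | tmul x y =>
        rw [TensorProduct.map_tmul, LinearMap.rTensor_tmul, Submodule.subtype_apply,
          hlow [i] (by simp) x x.2]
        simp
    · obtain ⟨z, rfl⟩ := hb
      induction z with
      | zero => simp
      | add z z' hz hz' => simp only [map_add]; exact add_mem hz hz'
      | tmul x y =>
        rw [TensorProduct.map_tmul, LinearMap.rTensor_tmul, TensorProduct.lid_tmul]
        exact (I.restrictScalars K).smul_mem _ y.2
  intro y hy w
  induction w generalizing y with
  | nil => exact hlow [] (by simp) y hy
  | cons i w ih => exact ih (hstable i y hy)

theorem nicholsIdeal_eq_radical : nicholsIdeal Q = radical Q :=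
  le_antisymm (sSup_le fun _ hI => IsHomogeneousBiideal.le_radical Q hI)
    (le_sSup (radical_isHomogeneousBiideal Q))

variable {Q}

theorem toNichols_eq_zero_iff {y : FreeAlgebra K (Fin n)} :
    toNichols Q y = 0 ↔ y ∈ radical Q := by
  rw [← nicholsIdeal_eq_radical]
  exact Ideal.Quotient.eq_zero_iff_mem

variable (Q) in
/-- The canonical map `T(V) → B(V)` as a linear map. -/
def toNicholsLin : FreeAlgebra K (Fin n) →ₗ[K] NicholsAlgebra Q where
  toFun := toNichols Q
  map_add' := map_add _
  map_smul' _ _ := rfl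

theorem toNichols_smul (c : K) (y : FreeAlgebra K (Fin n)) :
    toNichols Q (c • y) = c • toNichols Q y := rfl

end Radical

/-! ### Raising and lowering operators on coefficient sequences -/

section Operators

variable {A : Type*} [CommRing A]

/-- The scalars `β_j = (j)_q (1 - q ^ (j - 1) r)`, given by a recursion which avoids the
exponent `j - 1`. -/
def lowCoeff (q r : A) : ℕ → A
  | 0 => 0
  | j + 1 => 1 - q ^ (2 * j) * r + q * lowCoeff q r j

theorem lowCoeff_succ (q r : A) (j : ℕ) :
    lowCoeff q r (j + 1) = (∑ i ∈ Finset.range (j + 1), q ^ i) * (1 - q ^ j * r) := by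
  induction j with
  | zero => simp [lowCoeff]
  | succ j ih =>
    have h1 := geom_sum_succ (x := q) (n := j + 1)
    have h2 := geom_sum_succ' (x := q) (n := j + 1)
    rw [lowCoeff, ih, h1]
    have h3 : q * (∑ i ∈ Finset.range (j + 1), q ^ i) + 1 =
        q ^ (j + 1) + ∑ i ∈ Finset.range (j + 1), q ^ i := by rw [← h1, h2]
    linear_combination q ^ (j + 1) * r * h3

theorem map_lowCoeff {B : Type*} [CommRing B] (φ : A →+* B) (q r : A) (j : ℕ) :
    φ (lowCoeff q r j) = lowCoeff (φ q) (φ r) j := by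
  induction j with
  | zero => simp [lowCoeff]
  | succ j ih => simp [lowCoeff, ih]

/-- A sequence `c` supported on `{0, …, m}` stands for `∑ c_a u_a u_{m - a}`, where
`u_j = (ad x_1)^j (x_2)`. The raising operator is the action of `ad x_1`. -/
def raiseOp (q p : A) : (ℕ → A) →ₗ[A] (ℕ → A) where
  toFun c a := (match a with | 0 => 0 | a + 1 => c a) + q ^ a * p * c a
  map_add' c d := by
    funext a
    cases a <;> simp <;> ring
  map_smul' x c := by
    funext a
    cases a <;> simp <;> ring

/-- The action of the skew derivation `∂_1` on `∑ c_a u_a u_{m - a}`, in terms of the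
coefficients. -/
def lowerOp (q p t : A) (m : ℕ) : (ℕ → A) →ₗ[A] (ℕ → A) where
  toFun c a := lowCoeff q (p * t) (a + 1) * c (a + 1) +
    q ^ a * t * lowCoeff q (p * t) (m - a) * c a
  map_add' c d := by
    funext a
    simp; ring
  map_smul' x c := by
    funext a
    simp; ring

theorem raiseOp_zero (q p : A) (c : ℕ → A) : raiseOp q p c 0 = p * c 0 := by
  simp [raiseOp]

theorem raiseOp_succ (q p : A) (c : ℕ → A) (a : ℕ) :
    raiseOp q p c (a + 1) = c a + q ^ (a + 1) * p * c (a + 1) := rfl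

theorem lowerOp_apply (q p t : A) (m : ℕ) (c : ℕ → A) (a : ℕ) :
    lowerOp q p t m c a = lowCoeff q (p * t) (a + 1) * c (a + 1) +
      q ^ a * t * lowCoeff q (p * t) (m - a) * c a := rfl

/-- The sequences supported on `{0, …, m}`. -/
def suppLE (A : Type*) [CommRing A] (m : ℕ) : Submodule A (ℕ → A) where
  carrier := {c | ∀ a, m < a → c a = 0}
  add_mem' hc hd a ha := by simp [hc a ha, hd a ha]
  zero_mem' a _ := rfl
  smul_mem' x c hc a ha := by simp [hc a ha]

theorem raiseOp_mem_suppLE {q p : A} {m : ℕ} {c : ℕ → A} (hc : c ∈ suppLE A m) :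
    raiseOp q p c ∈ suppLE A (m + 1) := by
  intro a ha
  obtain ⟨a, rfl⟩ := Nat.exists_eq_succ_of_ne_zero (by omega : a ≠ 0)
  rw [Nat.succ_eq_add_one] at *
  rw [raiseOp_succ, hc a (by omega), hc (a + 1) (by omega)]
  simp

/-- The commutation rule of the raising and the lowering operators. -/
theorem lowerOp_raiseOp (q p t : A) {m : ℕ} {c : ℕ → A} (hc : c ∈ suppLE A m) :
    lowerOp q p t (m + 1) (raiseOp q p c) =
      q • raiseOp q p (lowerOp q p t m c) + (1 - q ^ (2 * m) * (p * t) ^ 2) • c := by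
  funext a
  simp only [Pi.add_apply, Pi.smul_apply, smul_eq_mul]
  cases a with
  | zero =>
    simp only [lowerOp_apply, raiseOp_zero, raiseOp_succ, Nat.sub_zero, lowCoeff]
    ring
  | succ a =>
    rcases lt_or_ge a m with ham | ham
    · obtain ⟨b, rfl⟩ := Nat.exists_eq_add_of_lt ham
      simp only [lowerOp_apply, raiseOp_succ, show a + b + 1 + 1 - (a + 1) = b + 1 by omega,
        show a + b + 1 - a = b + 1 by omega, show a + b + 1 - (a + 1) = b by omega, lowCoeff]
      ring
    · have h1 := hc (a + 1) (by omega)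
      have h2 := hc (a + 1 + 1) (by omega)
      simp only [lowerOp_apply, raiseOp_succ, show m + 1 - (a + 1) = 0 by omega,
        show m - a = 0 by omega, show m - (a + 1) = 0 by omega, h1, h2, lowCoeff]
      ring

theorem iterate_raiseOp_mem_suppLE {q p : A} {m : ℕ} {c : ℕ → A} (hc : c ∈ suppLE A m) (i : ℕ) :
    (raiseOp q p)^[i] c ∈ suppLE A (m + i) := by
  induction i with
  | zero => exact hc
  | succ i ih =>
    rw [Function.iterate_succ_apply']
    exact raiseOp_mem_suppLE ih

theorem iterate_raiseOp_bot (q p : A) (c : ℕ → A) (i : ℕ) :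
    (raiseOp q p)^[i] c 0 = p ^ i * c 0 := by
  induction i with
  | zero => simp
  | succ i ih => rw [Function.iterate_succ_apply', raiseOp_zero, ih, pow_succ']; ring

theorem iterate_raiseOp_top (q p : A) {m : ℕ} {c : ℕ → A} (hc : c ∈ suppLE A m) (i : ℕ) :
    (raiseOp q p)^[i] c (m + i) = c m := by
  induction i with
  | zero => rfl
  | succ i ih =>
    rw [Function.iterate_succ_apply', ← add_assoc, raiseOp_succ, ih,
      iterate_raiseOp_mem_suppLE hc i (m + i + 1) (by omega)]
    simp

/-- The vector in degree `m` which is annihilated by the lowering operator. It is unique up to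
scalars if `β_1, …, β_m` are nonzero. -/
def singVec (q p t : A) (m : ℕ) : ℕ → A := fun a =>
  if a ≤ m then (-t) ^ a * q ^ (a * (a - 1) / 2) *
    (∏ i ∈ Finset.range a, lowCoeff q (p * t) (m - i)) *
      ∏ i ∈ Finset.Ico a m, lowCoeff q (p * t) (i + 1) else 0

/-- The product `β_1 β_2 ⋯ β_m`. -/
def lowProd (q r : A) (m : ℕ) : A := ∏ i ∈ Finset.range m, lowCoeff q r (i + 1)

theorem singVec_mem_suppLE (q p t : A) (m : ℕ) : singVec q p t m ∈ suppLE A m := by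
  intro a ha
  rw [singVec, if_neg (by omega)]

theorem singVec_bot (q p t : A) (m : ℕ) : singVec q p t m 0 = lowProd q (p * t) m := by
  simp [singVec, lowProd]

theorem singVec_top (q p t : A) (m : ℕ) :
    singVec q p t m m = (-t) ^ m * q ^ (m * (m - 1) / 2) * lowProd q (p * t) m := by
  rw [singVec, if_pos le_rfl, Finset.Ico_self, Finset.prod_empty, mul_one, lowProd,
    ← Finset.prod_range_reflect]
  congr 1
  refine Finset.prod_congr rfl fun i hi => ?_
  rw [Finset.mem_range] at hi
  congr 1
  omega

theorem lowerOp_singVec (q p t : A) (m : ℕ) : lowerOp q p t m (singVec q p t m) = 0 := by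
  funext a
  rw [lowerOp_apply, Pi.zero_apply]
  rcases lt_trichotomy a m with h | h | h
  · rw [singVec, singVec, if_pos (Nat.succ_le_of_lt h), if_pos h.le, Finset.prod_range_succ,
      Nat.triangle_succ, Finset.prod_eq_prod_Ico_succ_bot h]
    ring
  · subst h
    rw [singVec_mem_suppLE q p t a (a + 1) (by omega), Nat.sub_self, lowCoeff]
    ring
  · rw [singVec_mem_suppLE q p t m (a + 1) (by omega), singVec_mem_suppLE q p t m a h]
    ring

/-- Raising and then lowering acts by a scalar on raised singular vectors: the scalars satisfy the
same recursion as the `β_j`, with `r` replaced by `q ^ (2 n) r ^ 2`. -/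
theorem lowerOp_iterate_raiseOp_singVec (q p t : A) (n i : ℕ) :
    lowerOp q p t (n + (i + 1)) ((raiseOp q p)^[i + 1] (singVec q p t n)) =
      lowCoeff q (q ^ (2 * n) * (p * t) ^ 2) (i + 1) • (raiseOp q p)^[i] (singVec q p t n) := by
  induction i with
  | zero =>
    rw [Function.iterate_succ_apply', zero_add,
      lowerOp_raiseOp q p t (iterate_raiseOp_mem_suppLE (singVec_mem_suppLE q p t n) 0)]
    simp [lowerOp_singVec, lowCoeff]
  | succ i ih =>
    rw [Function.iterate_succ_apply', ← add_assoc,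
      lowerOp_raiseOp q p t (iterate_raiseOp_mem_suppLE (singVec_mem_suppLE q p t n) (i + 1)),
      ih, map_smul, ← Function.iterate_succ_apply' (raiseOp q p), smul_smul, ← add_smul]
    congr 1
    conv_rhs => rw [lowCoeff]
    ring

theorem map_raiseOp {B : Type*} [CommRing B] (φ : A →+* B) (q p : A) (c : ℕ → A) :
    φ ∘ raiseOp q p c = raiseOp (φ q) (φ p) (φ ∘ c) := by
  funext a
  cases a <;> simp [raiseOp_zero, raiseOp_succ]

theorem map_iterate_raiseOp {B : Type*} [CommRing B] (φ : A →+* B) (q p : A) (c : ℕ → A)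
    (i : ℕ) : φ ∘ (raiseOp q p)^[i] c = (raiseOp (φ q) (φ p))^[i] (φ ∘ c) := by
  induction i with
  | zero => rfl
  | succ i ih => rw [Function.iterate_succ_apply', Function.iterate_succ_apply', map_raiseOp, ih]

theorem map_singVec {B : Type*} [CommRing B] (φ : A →+* B) (q p t : A) (m : ℕ) :
    φ ∘ singVec q p t m = singVec (φ q) (φ p) (φ t) m := by
  funext a
  simp only [Function.comp_apply, singVec]
  split_ifs <;> simp [map_lowCoeff]

theorem map_lowProd {B : Type*} [CommRing B] (φ : A →+* B) (q r : A) (m : ℕ) :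
    φ (lowProd q r m) = lowProd (φ q) (φ r) m := by
  simp [lowProd, map_lowCoeff]

end Operators

section Singular

variable {K : Type*} [Field K]

theorem eq_zero_of_lowerOp_eq_zero {q p t : K} {m : ℕ}
    (hβ : ∀ i < m, lowCoeff q (p * t) (i + 1) ≠ 0) {c : ℕ → K} (hc : c ∈ suppLE K m)
    (hD : lowerOp q p t m c = 0) (h0 : c 0 = 0) : c = 0 := by
  funext a
  induction a with
  | zero => exact h0
  | succ a ih =>
    rcases lt_or_ge a m with h | h
    · have := congrFun hD a
      rw [lowerOp_apply, show c a = 0 from ih, mul_zero, add_zero] at this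
      exact (mul_eq_zero.1 this).resolve_left (hβ a h)
    · exact hc _ (by omega)

theorem lowProd_ne_zero {q r : K} {m : ℕ} (hβ : ∀ i < m, lowCoeff q r (i + 1) ≠ 0) :
    lowProd q r m ≠ 0 :=
  Finset.prod_ne_zero_iff.2 fun i hi => hβ i (Finset.mem_range.1 hi)

theorem eq_smul_singVec {q p t : K} {m : ℕ}
    (hβ : ∀ i < m, lowCoeff q (p * t) (i + 1) ≠ 0) {c : ℕ → K} (hc : c ∈ suppLE K m)
    (hD : lowerOp q p t m c = 0) :
    c = (c 0 / lowProd q (p * t) m) • singVec q p t m := by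
  rw [← sub_eq_zero]
  apply eq_zero_of_lowerOp_eq_zero hβ
  · exact sub_mem hc (Submodule.smul_mem _ _ (singVec_mem_suppLE q p t m))
  · rw [map_sub, map_smul, hD, lowerOp_singVec, smul_zero, sub_zero]
  · rw [Pi.sub_apply, Pi.smul_apply, singVec_bot, smul_eq_mul,
      div_mul_cancel₀ _ (lowProd_ne_zero hβ), sub_self]

/-- The functional whose vanishing on a coefficient sequence expresses the vanishing of the skew
derivative `∂_2` of `∑ c_a u_a u_{m - a}`. -/
def endFunctional (p s : K) (m : ℕ) : (ℕ → K) →ₗ[K] K where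
  toFun c := c 0 + p ^ m * s * c m
  map_add' c d := by simp; ring
  map_smul' x c := by simp; ring

theorem endFunctional_apply (p s : K) (m : ℕ) (c : ℕ → K) :
    endFunctional p s m c = c 0 + p ^ m * s * c m := rfl

theorem endFunctional_singVec (q p t s : K) (m : ℕ) :
    endFunctional p s m (singVec q p t m) =
      lowProd q (p * t) m * (1 + q ^ (m * (m - 1) / 2) * (-(p * t)) ^ m * s) := by
  rw [endFunctional_apply, singVec_bot, singVec_top, show -(p * t) = p * (-t) by ring, mul_pow]
  ring

open DualNumber in
/-- Let `m = n + i + 1`, and let `P_j` be the singular vector of degree `j`. Under the condition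
`hlink`, the vector `(ad x_1) ^ (i + 1) P_n` is a multiple of `P_m`. The vector `z` is the
derivative, with respect to `log q_{21}`, of a combination of these two vectors which vanishes at
the given parameters. It is computed with `q_{21} (1 + ε)` over the dual numbers. Up to scalars,
the functional takes the value `m - n` at `z`, so characteristic zero matters here. -/
theorem exists_lowerOp_eq_smul_iterate [CharZero K] {q p t s : K} {n i : ℕ} (hp : p ≠ 0)
    (hβ : ∀ j < n + (i + 1), lowCoeff q (p * t) (j + 1) ≠ 0)
    (hi : ∑ j ∈ Finset.range (i + 1), q ^ j ≠ 0)
    (hlink : q ^ (2 * n + i) * (p * t) ^ 2 = 1)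
    (hn : q ^ (n * (n - 1) / 2) * (-(p * t)) ^ n * s = -1)
    (hm : q ^ ((n + (i + 1)) * (n + (i + 1) - 1) / 2) * (-(p * t)) ^ (n + (i + 1)) * s = -1) :
    ∃ z ∈ suppLE K (n + (i + 1)), ∃ x : K, x ≠ 0 ∧
      lowerOp q p t (n + (i + 1)) z = x • (raiseOp q p)^[i] (singVec q p t n) ∧
      endFunctional p s (n + (i + 1)) z ≠ 0 := by
  set m := n + (i + 1) with hmdef
  let φ : DualNumber K →+* K := (TrivSqZeroExt.fstHom K K K).toRingHom
  have hφ : ∀ x : DualNumber K, φ x = TrivSqZeroExt.fst x := fun _ => rfl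
  let q' : DualNumber K := TrivSqZeroExt.inl q
  let p' : DualNumber K := TrivSqZeroExt.inl p
  -- The parameter `q_{21} (1 + ε)`.
  let t' : DualNumber K := TrivSqZeroExt.inl t + TrivSqZeroExt.inr t
  have hq' : φ q' = q := by simp [hφ, q']
  have hp' : φ p' = p := by simp [hφ, p']
  have ht' : φ t' = t := by simp [hφ, t']
  have snd_mul' : ∀ x y : DualNumber K, TrivSqZeroExt.snd (x * y) =
      TrivSqZeroExt.fst x * TrivSqZeroExt.snd y + TrivSqZeroExt.fst y * TrivSqZeroExt.snd x := by
    intro x y; simp [mul_comm]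
  have hqpow : ∀ j, q' ^ j = TrivSqZeroExt.inl (q ^ j) := fun j => by
    simp [q', TrivSqZeroExt.inl_pow]
  have hppow : ∀ j, p' ^ j = TrivSqZeroExt.inl (p ^ j) := fun j => by
    simp [p', TrivSqZeroExt.inl_pow]
  have htfst : ∀ j, TrivSqZeroExt.fst ((-t') ^ j) = (-t) ^ j := fun j => by
    simp [t']
  have htsnd : ∀ j : ℕ, TrivSqZeroExt.snd ((-t') ^ j) = j * (-t) ^ j := by
    intro j
    induction j with
    | zero => simp
    | succ j ih =>
      rw [pow_succ, snd_mul', htfst, ih]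
      simp [t']
      ring
  let B : ℕ → DualNumber K := fun j => lowProd q' (p' * t') j
  have hB : ∀ j, TrivSqZeroExt.fst (B j) = lowProd q (p * t) j := by
    intro j
    rw [← hφ, map_lowProd, map_mul, hq', hp', ht']
  have hBn : lowProd q (p * t) n ≠ 0 := lowProd_ne_zero fun j hj => hβ j (by omega)
  have hBm : lowProd q (p * t) m ≠ 0 := lowProd_ne_zero hβ
  let w : ℕ → DualNumber K := B m • (raiseOp q' p')^[i + 1] (singVec q' p' t' n) -
    (p' ^ (i + 1) * B n) • singVec q' p' t' m
  have hwsupp : w ∈ suppLE (DualNumber K) m :=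
    sub_mem (Submodule.smul_mem _ _ (iterate_raiseOp_mem_suppLE (singVec_mem_suppLE _ _ _ _) _))
      (Submodule.smul_mem _ _ (singVec_mem_suppLE _ _ _ _))
  have hw0 : w 0 = 0 := by
    simp only [w, Pi.sub_apply, Pi.smul_apply, iterate_raiseOp_bot, singVec_bot, smul_eq_mul, B]
    ring
  have hwm : w m = B m * B n * ((-t') ^ n * q' ^ (n * (n - 1) / 2) -
      p' ^ (i + 1) * ((-t') ^ m * q' ^ (m * (m - 1) / 2))) := by
    have h := iterate_raiseOp_top q' p' (singVec_mem_suppLE q' p' t' n) (i + 1)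
    rw [← hmdef] at h
    simp only [w, Pi.sub_apply, Pi.smul_apply, h, singVec_top, smul_eq_mul, B]
    ring
  have hDw : lowerOp q' p' t' m w = (B m * lowCoeff q' (q' ^ (2 * n) * (p' * t') ^ 2) (i + 1)) •
      (raiseOp q' p')^[i] (singVec q' p' t' n) := by
    simp only [w, map_sub, map_smul, lowerOp_singVec, smul_zero, sub_zero]
    rw [hmdef, lowerOp_iterate_raiseOp_singVec, smul_smul]
  -- The scalar in `hDw` is infinitesimal, because it vanishes at the given parameters.
  have hγfst : TrivSqZeroExt.fst (lowCoeff q' (q' ^ (2 * n) * (p' * t') ^ 2) (i + 1)) = 0 := by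
    rw [← hφ, map_lowCoeff, lowCoeff_succ]
    simp only [map_mul, map_pow, hq', hp', ht']
    rw [← mul_assoc, ← pow_add, add_comm i (2 * n), hlink, sub_self, mul_zero]
  have hγsnd : TrivSqZeroExt.snd (lowCoeff q' (q' ^ (2 * n) * (p' * t') ^ 2) (i + 1)) =
      -2 * ∑ j ∈ Finset.range (i + 1), q ^ j := by
    have h1 : 1 - q' ^ i * (q' ^ (2 * n) * (p' * t') ^ 2) = TrivSqZeroExt.inr (-2) := by
      rw [← mul_assoc, ← pow_add, add_comm i (2 * n), hqpow, mul_pow, hppow]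
      apply TrivSqZeroExt.ext
      · simp [t']
        linear_combination -hlink
      · simp [t', sq]
        linear_combination 2 * hlink
    rw [lowCoeff_succ, h1, snd_mul', ← hφ, map_sum]
    simp [hq', mul_comm]
  have hfst : ∀ a, TrivSqZeroExt.fst (w a) = 0 := by
    have hcomp : φ ∘ w ∈ suppLE K m := fun a ha => by simp [hwsupp a ha]
    have h : φ ∘ w = 0 := by
      refine eq_zero_of_lowerOp_eq_zero hβ hcomp ?_ (by simp [hw0])
      funext a
      have := congrArg φ (congrFun hDw a)
      rw [lowerOp_apply, Pi.smul_apply, smul_eq_mul, map_mul, map_mul, hφ (lowCoeff _ _ (i + 1)),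
        hγfst, mul_zero, zero_mul] at this
      simp only [map_add, map_mul, map_pow, map_lowCoeff, hq', hp', ht'] at this
      exact this
    exact fun a => congrFun h a
  refine ⟨fun a => TrivSqZeroExt.snd (w a), fun a ha => ?_,
    lowProd q (p * t) m * (-2 * ∑ j ∈ Finset.range (i + 1), q ^ j), ?_, ?_, ?_⟩
  · simp only [hwsupp a ha, TrivSqZeroExt.snd_zero]
  · exact mul_ne_zero hBm (mul_ne_zero (by norm_num) hi)
  · funext a
    have := congrArg TrivSqZeroExt.snd (congrFun hDw a)
    have hR : ∀ x, TrivSqZeroExt.snd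
        (B m * lowCoeff q' (q' ^ (2 * n) * (p' * t') ^ 2) (i + 1) * x) =
        lowProd q (p * t) m * (-2 * ∑ j ∈ Finset.range (i + 1), q ^ j) * TrivSqZeroExt.fst x := by
      intro x
      rw [snd_mul', snd_mul', TrivSqZeroExt.fst_mul, hγfst, hB, hγsnd]
      ring
    rw [lowerOp_apply, Pi.smul_apply, smul_eq_mul, TrivSqZeroExt.snd_add, snd_mul' _ (w (a + 1)),
      snd_mul' _ (w a), hfst, hfst, hR] at this
    rw [lowerOp_apply, Pi.smul_apply, smul_eq_mul]
    have e1 : TrivSqZeroExt.fst ((raiseOp q' p')^[i] (singVec q' p' t' n) a) =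
        (raiseOp q p)^[i] (singVec q p t n) a := by
      have := congrFun (map_iterate_raiseOp φ q' p' (singVec q' p' t' n) i) a
      rw [map_singVec, hq', hp', ht'] at this
      exact this
    have e2 : ∀ j, TrivSqZeroExt.fst (lowCoeff q' (p' * t') j) = lowCoeff q (p * t) j := by
      intro j
      rw [← hφ, map_lowCoeff, map_mul, hq', hp', ht']
    have e3 : TrivSqZeroExt.fst (q' ^ a * t' * lowCoeff q' (p' * t') (m - a)) =
        q ^ a * t * lowCoeff q (p * t) (m - a) := by
      rw [TrivSqZeroExt.fst_mul, e2, ← hφ, map_mul, map_pow, hq', ht']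
    rw [e1, e2, e3] at this
    linear_combination this
  · have hz : TrivSqZeroExt.snd (w m) = lowProd q (p * t) m * lowProd q (p * t) n *
        (n * (-t) ^ n * q ^ (n * (n - 1) / 2) -
          p ^ (i + 1) * (m * (-t) ^ m * q ^ (m * (m - 1) / 2))) := by
      have hbr : TrivSqZeroExt.fst ((-t') ^ n * q' ^ (n * (n - 1) / 2) -
          p' ^ (i + 1) * ((-t') ^ m * q' ^ (m * (m - 1) / 2))) = 0 := by
        have := hfst m
        rw [hwm, TrivSqZeroExt.fst_mul, TrivSqZeroExt.fst_mul, hB, hB] at this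
        exact (mul_eq_zero.1 this).resolve_left (mul_ne_zero hBm hBn)
      rw [hwm, snd_mul', hbr, TrivSqZeroExt.fst_mul, hB, hB, hqpow, hqpow, hppow]
      simp only [TrivSqZeroExt.snd_sub, snd_mul', htsnd, htfst, TrivSqZeroExt.snd_inl,
        TrivSqZeroExt.fst_inl]
      ring
    have hpm : p ^ m = p ^ n * p ^ (i + 1) := by rw [hmdef, pow_add]
    rw [endFunctional_apply]
    simp only [hw0, hz, TrivSqZeroExt.snd_zero, zero_add]
    rw [show -(p * t) = p * (-t) by ring, mul_pow] at hn hm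
    have : p ^ m * s * (lowProd q (p * t) m * lowProd q (p * t) n *
        (n * (-t) ^ n * q ^ (n * (n - 1) / 2) -
          p ^ (i + 1) * (m * (-t) ^ m * q ^ (m * (m - 1) / 2)))) =
        lowProd q (p * t) m * lowProd q (p * t) n * p ^ (i + 1) * (i + 1) := by
      have hm' : (m : K) = n + (i + 1) := by rw [hmdef]; push_cast; ring
      have hn' : p ^ m * s * ((-t) ^ n * q ^ (n * (n - 1) / 2)) = - p ^ (i + 1) := by
        rw [hpm]; linear_combination p ^ (i + 1) * hn
      have hm'' : p ^ m * s * ((-t) ^ m * q ^ (m * (m - 1) / 2)) = - 1 := by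
        linear_combination hm
      linear_combination lowProd q (p * t) m * lowProd q (p * t) n * n * hn' -
        lowProd q (p * t) m * lowProd q (p * t) n * p ^ (i + 1) * m * hm'' +
        lowProd q (p * t) m * lowProd q (p * t) n * p ^ (i + 1) * hm'
    rw [this]
    refine mul_ne_zero (mul_ne_zero (mul_ne_zero hBm hBn) (pow_ne_zero _ hp)) ?_
    exact_mod_cast Nat.succ_ne_zero i

end Singular

/-! ### The space of relations -/

section Relations

variable {K : Type*} [Field K]

/-- The coefficient sequences `c` of the relations `∑ c_a u_a u_{m - a} = 0` in the Nichols
algebra. A relation is characterized by the vanishing of its skew derivative `∂_2`, and by its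
skew derivative `∂_1` being a relation in degree `m - 1`. -/
def relSpace (q p t s : K) : ℕ → Submodule K (ℕ → K)
  | 0 => suppLE K 0 ⊓ LinearMap.ker (endFunctional p s 0)
  | m + 1 => suppLE K (m + 1) ⊓ LinearMap.ker (endFunctional p s (m + 1)) ⊓
      (relSpace q p t s m).comap (lowerOp q p t (m + 1))

variable {q p t s : K}

theorem mem_relSpace_zero {c : ℕ → K} :
    c ∈ relSpace q p t s 0 ↔ c ∈ suppLE K 0 ∧ endFunctional p s 0 c = 0 := by
  simp [relSpace]

theorem mem_relSpace_succ {m : ℕ} {c : ℕ → K} :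
    c ∈ relSpace q p t s (m + 1) ↔ c ∈ suppLE K (m + 1) ∧ endFunctional p s (m + 1) c = 0 ∧
      lowerOp q p t (m + 1) c ∈ relSpace q p t s m := by
  simp [relSpace, and_assoc]

theorem relSpace_le_suppLE (m : ℕ) : relSpace q p t s m ≤ suppLE K m := by
  intro c hc
  cases m with
  | zero => exact (mem_relSpace_zero.1 hc).1
  | succ m => exact (mem_relSpace_succ.1 hc).1

theorem endFunctional_of_mem_relSpace {m : ℕ} {c : ℕ → K} (hc : c ∈ relSpace q p t s m) :
    endFunctional p s m c = 0 := by
  cases m with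
  | zero => exact (mem_relSpace_zero.1 hc).2
  | succ m => exact (mem_relSpace_succ.1 hc).2.1

theorem lowerOp_zero_of_mem {c : ℕ → K} (hc : c ∈ suppLE K 0) : lowerOp q p t 0 c = 0 := by
  funext a
  rw [lowerOp_apply, hc (a + 1) (by omega), Nat.zero_sub, lowCoeff]
  simp

theorem mem_relSpace_of_lowerOp_eq_zero {m : ℕ} {c : ℕ → K} (hc : c ∈ suppLE K m)
    (hD : lowerOp q p t m c = 0) (hf : endFunctional p s m c = 0) : c ∈ relSpace q p t s m := by
  cases m with
  | zero => exact mem_relSpace_zero.2 ⟨hc, hf⟩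
  | succ m => exact mem_relSpace_succ.2 ⟨hc, hf, by rw [hD]; exact zero_mem _⟩

theorem endFunctional_raiseOp {m : ℕ} {c : ℕ → K} (hc : c ∈ suppLE K m) :
    endFunctional p s (m + 1) (raiseOp q p c) = p * endFunctional p s m c := by
  rw [endFunctional_apply, endFunctional_apply, raiseOp_zero, raiseOp_succ, hc (m + 1) (by omega)]
  ring

theorem raiseOp_mem_relSpace {m : ℕ} {c : ℕ → K} (hc : c ∈ relSpace q p t s m) :
    raiseOp q p c ∈ relSpace q p t s (m + 1) := by
  have hsupp := relSpace_le_suppLE m hc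
  refine mem_relSpace_succ.2 ⟨raiseOp_mem_suppLE hsupp, ?_, ?_⟩
  · rw [endFunctional_raiseOp hsupp, endFunctional_of_mem_relSpace hc, mul_zero]
  · rw [lowerOp_raiseOp q p t hsupp]
    refine add_mem (Submodule.smul_mem _ _ ?_) (Submodule.smul_mem _ _ hc)
    induction m generalizing c with
    | zero => rw [lowerOp_zero_of_mem hsupp, map_zero]; exact zero_mem _
    | succ m ih =>
      have hD := (mem_relSpace_succ.1 hc).2.2
      have hDs := relSpace_le_suppLE m hD
      refine mem_relSpace_succ.2 ⟨raiseOp_mem_suppLE hDs, ?_, ?_⟩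
      · rw [endFunctional_raiseOp hDs, endFunctional_of_mem_relSpace hD, mul_zero]
      · rw [lowerOp_raiseOp q p t hDs]
        exact add_mem (Submodule.smul_mem _ _ (ih hD hDs)) (Submodule.smul_mem _ _ hD)

theorem raiseOp_injective (hq : q ≠ 0) (hp : p ≠ 0) : Function.Injective (raiseOp q p) := by
  rw [← LinearMap.ker_eq_bot, LinearMap.ker_eq_bot']
  intro c hc
  funext a
  induction a with
  | zero =>
    have := congrFun hc 0
    rw [raiseOp_zero] at this
    exact (mul_eq_zero.1 this).resolve_left hp
  | succ a ih =>
    have := congrFun hc (a + 1)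
    rw [raiseOp_succ, show c a = 0 from ih, zero_add] at this
    exact (mul_eq_zero.1 this).resolve_left (mul_ne_zero (pow_ne_zero _ hq) hp)

instance finiteDimensional_suppLE (m : ℕ) : FiniteDimensional K (suppLE K m) := by
  let f : suppLE K m →ₗ[K] (Fin (m + 1) → K) :=
    (LinearMap.pi fun i : Fin (m + 1) => LinearMap.proj (i : ℕ)) ∘ₗ (suppLE K m).subtype
  refine FiniteDimensional.of_injective f ?_
  rw [← LinearMap.ker_eq_bot, LinearMap.ker_eq_bot']
  intro c hc
  apply Subtype.ext
  funext a
  rcases lt_or_ge a (m + 1) with h | h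
  · exact congrFun hc ⟨a, h⟩
  · exact c.2 a h

instance finiteDimensional_relSpace (m : ℕ) : FiniteDimensional K (relSpace q p t s m) :=
  Submodule.finiteDimensional_of_le (relSpace_le_suppLE m)

variable (q p t s) in
/-- The lowering operator as a map between spaces of relations. -/
def relLower (m : ℕ) : relSpace q p t s (m + 1) →ₗ[K] relSpace q p t s m :=
  (lowerOp q p t (m + 1)).restrict fun _ hc => (mem_relSpace_succ.1 hc).2.2

theorem finrank_relSpace_le_succ (hq : q ≠ 0) (hp : p ≠ 0) (m : ℕ) :
    Module.finrank K (relSpace q p t s m) ≤ Module.finrank K (relSpace q p t s (m + 1)) := by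
  refine LinearMap.finrank_le_finrank_of_injective
    (f := (raiseOp q p).restrict fun c (hc : c ∈ relSpace q p t s m) =>
      raiseOp_mem_relSpace hc) ?_
  intro c d h
  exact Subtype.ext (raiseOp_injective hq hp (congrArg Subtype.val h))

theorem finrank_ker_relLower_le {m : ℕ}
    (hβ : ∀ i < m + 1, lowCoeff q (p * t) (i + 1) ≠ 0) :
    Module.finrank K (LinearMap.ker (relLower q p t s m)) ≤ 1 := by
  have h := LinearMap.finrank_le_finrank_of_injective
    (f := (LinearMap.proj (0 : ℕ) : (ℕ → K) →ₗ[K] K) ∘ₗ (relSpace q p t s (m + 1)).subtype ∘ₗ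
      (LinearMap.ker (relLower q p t s m)).subtype) ?_
  · rwa [Module.finrank_self] at h
  · refine (injective_iff_map_eq_zero _).2 fun c hc => ?_
    apply Subtype.ext
    apply Subtype.ext
    exact eq_zero_of_lowerOp_eq_zero hβ (relSpace_le_suppLE _ c.1.2)
      (congrArg Subtype.val (LinearMap.mem_ker.1 c.2)) hc

/-- The dimension of the space of relations does not grow from degree `m` to degree `m + 1`, if
`m + 1` is not in `J`. If `m + 1` satisfies the first condition in the definition of `J`, this
holds since the lowering operator is not surjective. -/
theorem finrank_relSpace_succ_of_notMem [CharZero K] (hq : q ≠ 0) (hp : p ≠ 0) {m : ℕ}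
    (hβ : ∀ i < m + 1, lowCoeff q (p * t) (i + 1) ≠ 0) (hm : m + 1 ∉ setJ q (p * t) s) :
    Module.finrank K (relSpace q p t s (m + 1)) = Module.finrank K (relSpace q p t s m) := by
  refine le_antisymm ?_ (finrank_relSpace_le_succ hq hp m)
  have hrn := LinearMap.finrank_range_add_finrank_ker (relLower q p t s m)
  have hB := lowProd_ne_zero hβ
  by_cases h1 : q ^ ((m + 1) * (m + 1 - 1) / 2) * (-(p * t)) ^ (m + 1) * s = -1
  · rw [mem_setJ_iff] at hm
    push Not at hm
    obtain ⟨n, hnJ, hnm, hlink⟩ := hm h1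
    obtain ⟨i, rfl⟩ := Nat.exists_eq_add_of_le (Nat.lt_succ_iff.1 hnm)
    have hi : ∑ j ∈ Finset.range (i + 1), q ^ j ≠ 0 := by
      have := hβ i (by omega)
      rw [lowCoeff_succ] at this
      exact left_ne_zero_of_mul this
    have hn1 := ((mem_setJ_iff _ _ _ _).1 hnJ).1
    obtain ⟨z, hz, x, hx, hDz, hfz⟩ := exists_lowerOp_eq_smul_iterate (s := s) (n := n) (i := i)
      hp (fun j hj => hβ j (by omega)) hi
      (by rw [← hlink]; congr 2; omega) hn1 h1
    rw [← add_assoc] at hz hDz hfz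
    have hsing : (raiseOp q p)^[i] (singVec q p t n) ∈ relSpace q p t s (n + i) := by
      clear * - hn1
      induction i with
      | zero =>
        refine mem_relSpace_of_lowerOp_eq_zero (singVec_mem_suppLE _ _ _ _)
          (lowerOp_singVec _ _ _ _) ?_
        rw [Function.iterate_zero_apply, add_zero, endFunctional_singVec, hn1]
        ring
      | succ i ih =>
        rw [Function.iterate_succ_apply']
        exact raiseOp_mem_relSpace ih
    -- A preimage of the raised singular vector would differ from `x⁻¹ z` by a multiple of the
    -- singular vector of degree `n + i + 1`, on which the functional vanishes.
    have hlt : Module.finrank K (LinearMap.range (relLower q p t s (n + i))) <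
        Module.finrank K (relSpace q p t s (n + i)) := by
      refine Submodule.finrank_lt fun htop => ?_
      obtain ⟨y, hy⟩ := LinearMap.range_eq_top.1 htop ⟨_, hsing⟩
      have hy' : lowerOp q p t (n + i + 1) y = (raiseOp q p)^[i] (singVec q p t n) :=
        congrArg Subtype.val hy
      have hker := eq_smul_singVec hβ
        (sub_mem hz (Submodule.smul_mem _ x (relSpace_le_suppLE _ y.2)))
        (by rw [map_sub, map_smul]; rw [hDz, hy', sub_self])
      have hf := congrArg (endFunctional p s (n + i + 1)) hker
      rw [map_sub, map_smul, map_smul, endFunctional_of_mem_relSpace y.2,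
        endFunctional_singVec, h1] at hf
      apply hfz
      simpa using hf
    have hk := finrank_ker_relLower_le (s := s) hβ
    omega
  · have hk : LinearMap.ker (relLower q p t s m) = ⊥ := by
      rw [LinearMap.ker_eq_bot']
      intro c hc
      have hsupp := relSpace_le_suppLE _ c.2
      have hD : lowerOp q p t (m + 1) c = 0 := congrArg Subtype.val hc
      have hc' := eq_smul_singVec hβ hsupp hD
      have hf := endFunctional_of_mem_relSpace c.2
      rw [hc', map_smul, endFunctional_singVec, smul_eq_mul] at hf
      apply Subtype.ext
      refine eq_zero_of_lowerOp_eq_zero hβ hsupp hD ?_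
      rcases mul_eq_zero.1 hf with h | h
      · exact (div_eq_zero_iff.1 h).resolve_right hB
      · exact absurd (by linear_combination (mul_eq_zero.1 h).resolve_left hB) h1
    rw [hk, finrank_bot] at hrn
    have := Submodule.finrank_le (LinearMap.range (relLower q p t s m))
    omega

/-- The images of the singular vectors under powers of the raising operator. -/
def relGens (q p t s : K) (m : ℕ) : Set (ℕ → K) :=
  {c | ∃ j i, j ∈ setJ q (p * t) s ∧ j + i = m ∧ c = (raiseOp q p)^[i] (singVec q p t j)}

theorem singVec_mem_relSpace {j : ℕ} (hj : j ∈ setJ q (p * t) s) :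
    singVec q p t j ∈ relSpace q p t s j := by
  refine mem_relSpace_of_lowerOp_eq_zero (singVec_mem_suppLE _ _ _ _)
    (lowerOp_singVec _ _ _ _) ?_
  rw [endFunctional_singVec, ((mem_setJ_iff _ _ _ _).1 hj).1]
  ring

theorem relGens_subset (m : ℕ) : relGens q p t s m ⊆ relSpace q p t s m := by
  rintro _ ⟨j, i, hj, rfl, rfl⟩
  induction i with
  | zero => exact singVec_mem_relSpace hj
  | succ i ih =>
    rw [Function.iterate_succ_apply']
    exact raiseOp_mem_relSpace ih

theorem raiseOp_mem_span_relGens {m : ℕ} {c : ℕ → K}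
    (hc : c ∈ Submodule.span K (relGens q p t s m)) :
    raiseOp q p c ∈ Submodule.span K (relGens q p t s (m + 1)) := by
  have h := Submodule.mem_map_of_mem (f := raiseOp q p) hc
  rw [Submodule.map_span] at h
  refine Submodule.span_mono ?_ h
  rintro _ ⟨_, ⟨j, i, hj, rfl, rfl⟩, rfl⟩
  exact ⟨j, i + 1, hj, by omega, (Function.iterate_succ_apply' _ _ _).symm⟩

/-- If `m + 1 ∈ J`, then by the second condition in the definition of `J` the lowering operator
maps the span of the generators in degree `m + 1` onto the span of those in degree `m`. -/
theorem exists_lowerOp_eq_of_mem {m : ℕ}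
    (hβ : ∀ i < m + 1, lowCoeff q (p * t) (i + 1) ≠ 0) (hm : m + 1 ∈ setJ q (p * t) s)
    {c : ℕ → K} (hc : c ∈ Submodule.span K (relGens q p t s m)) :
    ∃ d ∈ Submodule.span K (relGens q p t s (m + 1)), lowerOp q p t (m + 1) d = c := by
  suffices h : Submodule.span K (relGens q p t s m) ≤
      (Submodule.span K (relGens q p t s (m + 1))).map (lowerOp q p t (m + 1)) from h hc
  rw [Submodule.span_le]
  rintro _ ⟨j, i, hj, rfl, rfl⟩
  have hγ : lowCoeff q (q ^ (2 * j) * (p * t) ^ 2) (i + 1) ≠ 0 := by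
    have h1 := hβ i (by omega)
    have h2 := ((mem_setJ_iff _ _ _ _).1 hm).2 j hj (by omega)
    rw [lowCoeff_succ] at h1 ⊢
    refine mul_ne_zero (left_ne_zero_of_mul h1) ?_
    rw [← mul_assoc, ← pow_add, show i + 2 * j = j + i + 1 + j - 1 by omega]
    exact sub_ne_zero.2 (Ne.symm h2)
  refine ⟨(lowCoeff q (q ^ (2 * j) * (p * t) ^ 2) (i + 1))⁻¹ •
    (raiseOp q p)^[i + 1] (singVec q p t j), Submodule.smul_mem _ _
      (Submodule.subset_span ⟨j, i + 1, hj, by omega, rfl⟩), ?_⟩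
  rw [map_smul, add_assoc, lowerOp_iterate_raiseOp_singVec, smul_smul, inv_mul_cancel₀ hγ, one_smul]

/-- The singular vectors of degree `j ∈ J` generate all relations under the raising operator, and
each of them contributes one dimension. -/
theorem relSpace_le_span_relGens_and_finrank [CharZero K] (hq : q ≠ 0) (hp : p ≠ 0) (m : ℕ)
    (hβ : ∀ i < m, lowCoeff q (p * t) (i + 1) ≠ 0) :
    relSpace q p t s m ≤ Submodule.span K (relGens q p t s m) ∧
      Module.finrank K (relSpace q p t s m) = (setJ q (p * t) s ∩ Set.Icc 0 m).ncard := by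
  induction m with
  | zero =>
    have h0 : 0 ∈ setJ q (p * t) s ↔ s = -1 := by
      rw [mem_setJ_iff]
      simp
    have hsing : ∀ c ∈ suppLE K 0, c = c 0 • singVec q p t 0 := by
      intro c hc
      have h := eq_smul_singVec (p := p) (t := t) (q := q) (m := 0) (by omega) hc
        (lowerOp_zero_of_mem hc)
      simpa [lowProd] using h
    by_cases hs : s = -1
    · have hJ : setJ q (p * t) s ∩ Set.Icc 0 0 = {0} := by
        ext j
        simp only [Set.mem_inter_iff, Set.Icc_self, Set.mem_singleton_iff]
        exact ⟨fun h => h.2, fun h => ⟨h ▸ h0.2 hs, h⟩⟩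
      have hle : relSpace q p t s 0 = K ∙ singVec q p t 0 := by
        apply le_antisymm
        · intro c hc
          rw [hsing c (relSpace_le_suppLE 0 hc)]
          exact Submodule.smul_mem _ _ (Submodule.mem_span_singleton_self _)
        · rw [Submodule.span_singleton_le_iff_mem]
          exact singVec_mem_relSpace (h0.2 hs)
      refine ⟨?_, ?_⟩
      · rw [hle]
        exact Submodule.span_mono (by
          rintro _ rfl
          exact ⟨0, 0, h0.2 hs, rfl, rfl⟩)
      · rw [hJ, Set.ncard_singleton, hle]
        apply finrank_span_singleton
        intro h
        have := congrFun h 0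
        rw [singVec_bot] at this
        simp [lowProd] at this
    · have hJ : setJ q (p * t) s ∩ Set.Icc 0 0 = ∅ := by
        ext j
        simp only [Set.mem_inter_iff, Set.Icc_self, Set.mem_singleton_iff,
          Set.mem_empty_iff_false, iff_false]
        rintro ⟨h, rfl⟩
        exact hs (h0.1 h)
      have hbot : relSpace q p t s 0 = ⊥ := by
        rw [Submodule.eq_bot_iff]
        intro c hc
        have hf := endFunctional_of_mem_relSpace hc
        rw [endFunctional_apply, pow_zero, one_mul,
          show c 0 + s * c 0 = (1 + s) * c 0 by ring] at hf
        have hc0 : c 0 = 0 := (mul_eq_zero.1 hf).resolve_left fun h =>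
          hs (by linear_combination h)
        rw [hsing c (relSpace_le_suppLE 0 hc), hc0, zero_smul]
      rw [hJ, Set.ncard_empty, hbot]
      exact ⟨bot_le, finrank_bot K _⟩
  | succ m ih =>
    obtain ⟨ihspan, ihrank⟩ := ih fun i hi => hβ i (by omega)
    have hfin : (setJ q (p * t) s ∩ Set.Icc 0 m).Finite := (Set.finite_Icc 0 m).inter_of_right _
    by_cases hm : m + 1 ∈ setJ q (p * t) s
    · have hJ : setJ q (p * t) s ∩ Set.Icc 0 (m + 1) =
          insert (m + 1) (setJ q (p * t) s ∩ Set.Icc 0 m) := by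
        ext j
        simp only [Set.mem_inter_iff, Set.mem_Icc, Set.mem_insert_iff]
        constructor
        · rintro ⟨h1, h2⟩
          by_cases h : j = m + 1
          · exact Or.inl h
          · exact Or.inr ⟨h1, by omega⟩
        · rintro (rfl | ⟨h1, h2⟩)
          · exact ⟨hm, by omega⟩
          · exact ⟨h1, by omega⟩
      have hsurj : LinearMap.range (relLower q p t s m) = ⊤ := by
        rw [LinearMap.range_eq_top]
        rintro ⟨c, hc⟩
        obtain ⟨d, hd, hdc⟩ := exists_lowerOp_eq_of_mem hβ hm (ihspan hc)
        exact ⟨⟨d, Submodule.span_le.2 (relGens_subset _) hd⟩, Subtype.ext hdc⟩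
      refine ⟨fun c hc => ?_, ?_⟩
      · obtain ⟨d, hd, hdc⟩ :=
          exists_lowerOp_eq_of_mem hβ hm (ihspan (mem_relSpace_succ.1 hc).2.2)
        have hk := eq_smul_singVec hβ
          (sub_mem (relSpace_le_suppLE _ hc)
            (relSpace_le_suppLE _ (Submodule.span_le.2 (relGens_subset _) hd)))
          (by rw [map_sub, hdc, sub_self])
        rw [← sub_add_cancel c d, hk]
        exact add_mem (Submodule.smul_mem _ _
          (Submodule.subset_span ⟨m + 1, 0, hm, rfl, rfl⟩)) hd
      · have hrn := LinearMap.finrank_range_add_finrank_ker (relLower q p t s m)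
        have hk := finrank_ker_relLower_le (s := s) hβ
        have hpos : 0 < Module.finrank K (LinearMap.ker (relLower q p t s m)) := by
          refine Nat.pos_of_ne_zero fun hzero => ?_
          have hbot := Submodule.finrank_eq_zero.1 hzero
          have hmem : (⟨_, singVec_mem_relSpace hm⟩ : relSpace q p t s (m + 1)) ∈
              LinearMap.ker (relLower q p t s m) :=
            Subtype.ext (lowerOp_singVec q p t (m + 1))
          rw [hbot, Submodule.mem_bot] at hmem
          exact lowProd_ne_zero hβ ((singVec_bot q p t (m + 1)).symm.trans
            (congrFun (congrArg Subtype.val hmem) 0))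
        rw [hsurj, finrank_top] at hrn
        rw [hJ, Set.ncard_insert_of_notMem (by simp) hfin]
        omega
    · have hJ : setJ q (p * t) s ∩ Set.Icc 0 (m + 1) = setJ q (p * t) s ∩ Set.Icc 0 m := by
        ext j
        simp only [Set.mem_inter_iff, Set.mem_Icc]
        constructor
        · rintro ⟨h1, h2⟩
          have : j ≠ m + 1 := fun h => hm (h ▸ h1)
          exact ⟨h1, by omega⟩
        · rintro ⟨h1, h2⟩
          exact ⟨h1, by omega⟩
      have hrank := finrank_relSpace_succ_of_notMem hq hp hβ hm
      refine ⟨?_, by rw [hJ, hrank, ihrank]⟩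
      have heq : (relSpace q p t s m).map (raiseOp q p) = relSpace q p t s (m + 1) := by
        refine Submodule.eq_of_le_of_finrank_eq ?_ ?_
        · rintro _ ⟨c, hc, rfl⟩
          exact raiseOp_mem_relSpace hc
        · rw [hrank]
          exact (Submodule.equivMapOfInjective _ (raiseOp_injective hq hp) _).finrank_eq.symm
      rw [← heq]
      rintro _ ⟨c, hc, rfl⟩
      exact raiseOp_mem_span_relGens (ihspan hc)

end Relations

/-! ### Leading terms of relations -/

section Leading

variable {K : Type*} [Field K] {q p t s : K}

/-- The sequences supported on `{l, …, m - l}`. -/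
def midSupp (K : Type*) [Field K] (m l : ℕ) : Submodule K (ℕ → K) where
  carrier := {c | ∀ a, a < l ∨ m < a + l → c a = 0}
  add_mem' hc hd a ha := by simp [hc a ha, hd a ha]
  zero_mem' a _ := rfl
  smul_mem' x c hc a ha := by simp [hc a ha]

theorem lowerOp_mem_midSupp {m l : ℕ} {c : ℕ → K} (hc : c ∈ midSupp K (m + 1) (l + 1)) :
    lowerOp q p t (m + 1) c ∈ midSupp K m l := by
  intro a ha
  rw [lowerOp_apply, hc (a + 1) (by omega), mul_zero, zero_add]
  rw [hc a (by omega), mul_zero]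

theorem raiseOp_mem_midSupp {m l : ℕ} {c : ℕ → K} (hc : c ∈ midSupp K m l) :
    raiseOp q p c ∈ midSupp K (m + 1) l := by
  intro a ha
  cases a with
  | zero => rw [raiseOp_zero, hc 0 (by omega), mul_zero]
  | succ a => rw [raiseOp_succ, hc a (by omega), hc (a + 1) (by omega), mul_zero, add_zero]

/-- The outermost coefficients of a relation supported on `{l, …, k}` have the ratio which occurs
in the braided commutator of `u_k` and `u_l`. -/
theorem coeff_of_mem_relSpace_of_mem_midSupp (k l : ℕ)
    (hβ : ∀ i < l, lowCoeff q (p * t) (i + 1) ≠ 0) {c : ℕ → K}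
    (hc : c ∈ relSpace q p t s (k + l)) (hcs : c ∈ midSupp K (k + l) l) :
    c l + q ^ (k * l) * p ^ k * t ^ l * s * c k = 0 := by
  induction l generalizing c with
  | zero =>
    have := endFunctional_of_mem_relSpace hc
    rw [endFunctional_apply, add_zero] at this
    simpa using this
  | succ l ih =>
    rw [← add_assoc] at hc hcs
    have h := ih (fun i hi => hβ i (by omega)) (mem_relSpace_succ.1 hc).2.2
      (lowerOp_mem_midSupp hcs)
    rw [lowerOp_apply, lowerOp_apply, hcs l (by omega), hcs (k + 1) (by omega),
      show k + l + 1 - k = l + 1 by omega] at h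
    have hne := hβ l (by omega)
    apply (mul_eq_zero.1 (?_ : lowCoeff q (p * t) (l + 1) * _ = 0)).resolve_left hne
    rw [mul_add, pow_succ t, mul_add k, pow_add q]
    linear_combination h

/-- There is a relation in degree `m` supported on `{l, …, m - l}` with nonzero coefficient of
`u_{m - l} u_l`. -/
def HasLeading (q p t s : K) (m l : ℕ) : Prop :=
  ∃ c ∈ relSpace q p t s m, c ∈ midSupp K m l ∧ l ≤ m ∧ c (m - l) ≠ 0

/-- Lowering and then raising a relation shifts its leading term one step outwards, since the
scalars `β_i` do not vanish. -/
theorem HasLeading.of_succ (hq : q ≠ 0) (ht : t ≠ 0) {m l : ℕ}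
    (hβ : ∀ i < m, lowCoeff q (p * t) (i + 1) ≠ 0) (h : HasLeading q p t s m (l + 1)) :
    HasLeading q p t s m l := by
  obtain ⟨c, hc, hcs, hlm, htop⟩ := h
  obtain ⟨m, rfl⟩ := Nat.exists_eq_succ_of_ne_zero (by omega : m ≠ 0)
  rw [Nat.succ_eq_add_one] at *
  have hDs : lowerOp q p t (m + 1) c ∈ midSupp K m l := lowerOp_mem_midSupp hcs
  refine ⟨_, raiseOp_mem_relSpace (mem_relSpace_succ.1 hc).2.2, raiseOp_mem_midSupp hDs,
    by omega, ?_⟩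
  rw [show m + 1 - l = m - l + 1 by omega, raiseOp_succ, hDs (m - l + 1) (by omega), mul_zero,
    add_zero, lowerOp_apply, hcs (m - l + 1) (by omega), mul_zero, zero_add,
    show m + 1 - (m - l) = l + 1 by omega]
  rw [show m + 1 - (l + 1) = m - l by omega] at htop
  exact mul_ne_zero (mul_ne_zero (mul_ne_zero (pow_ne_zero _ hq) ht) (hβ l (by omega))) htop

theorem mem_midSupp_succ_of_coeff_eq_zero {m l : ℕ}
    (hβ : ∀ i < m, lowCoeff q (p * t) (i + 1) ≠ 0) {c : ℕ → K} (hc : c ∈ relSpace q p t s m)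
    (hcs : c ∈ midSupp K m l) (htop : c (m - l) = 0) : c ∈ midSupp K m (l + 1) := by
  rcases lt_or_ge m l with hml | hml
  · intro a _
    exact hcs a (by omega)
  have hbot : c l = 0 := by
    obtain ⟨k, rfl⟩ := Nat.exists_eq_add_of_le' hml
    have := coeff_of_mem_relSpace_of_mem_midSupp k l (fun i hi => hβ i (by omega)) hc hcs
    rw [Nat.add_sub_cancel] at htop
    rwa [htop, mul_zero, add_zero] at this
  intro a ha
  by_cases h1 : a = l
  · rw [h1, hbot]
  · by_cases h2 : a = m - l
    · rw [h2, htop]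
    · exact hcs a (by omega)

theorem mem_midSupp_succ_of_not_hasLeading {m l : ℕ}
    (hβ : ∀ i < m, lowCoeff q (p * t) (i + 1) ≠ 0) (h : ¬ HasLeading q p t s m l)
    {c : ℕ → K} (hc : c ∈ relSpace q p t s m) (hcs : c ∈ midSupp K m l) :
    c ∈ midSupp K m (l + 1) := by
  refine mem_midSupp_succ_of_coeff_eq_zero hβ hc hcs ?_
  by_contra hne
  refine h ⟨c, hc, hcs, ?_, hne⟩
  by_contra hml
  exact hne (hcs _ (by omega))

theorem relSpace_inf_midSupp_eq_bot (hq : q ≠ 0) (ht : t ≠ 0) {m l : ℕ}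
    (hβ : ∀ i < m, lowCoeff q (p * t) (i + 1) ≠ 0) (h : ¬ HasLeading q p t s m l) :
    relSpace q p t s m ⊓ midSupp K m l = ⊥ := by
  rw [Submodule.eq_bot_iff]
  rintro c ⟨hc, hcs⟩
  have hno : ∀ i, ¬ HasLeading q p t s m (l + i) := by
    intro i
    induction i with
    | zero => exact h
    | succ i ih => exact fun hl => ih (HasLeading.of_succ hq ht hβ hl)
  have hall : ∀ i, c ∈ midSupp K m (l + i) := by
    intro i
    induction i with
    | zero => exact hcs
    | succ i ih => exact mem_midSupp_succ_of_not_hasLeading hβ (hno i) hc ih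
  funext a
  exact hall (m + a + 1) a (by omega)

/-- The leading positions of the relations in degree `m` form the initial segment
`{0, …, d - 1}`, where `d` is the dimension of the space of relations: each position accounts for
at most one dimension, as both outermost coefficients of a relation vanish together. -/
theorem hasLeading_iff (hq : q ≠ 0) (ht : t ≠ 0) {m : ℕ}
    (hβ : ∀ i < m, lowCoeff q (p * t) (i + 1) ≠ 0) (l : ℕ) :
    HasLeading q p t s m l ↔ l < Module.finrank K (relSpace q p t s m) := by
  constructor
  · intro h
    have hdown : ∀ j ≤ l, HasLeading q p t s m (l - j) := by
      intro j
      induction j with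
      | zero => exact fun _ => h
      | succ j ih =>
        intro hj
        refine HasLeading.of_succ hq ht hβ ?_
        rw [show l - (j + 1) + 1 = l - j by omega]
        exact ih (by omega)
    have hfd : ∀ i, FiniteDimensional K
        (relSpace q p t s m ⊓ midSupp K m i : Submodule K (ℕ → K)) := fun i =>
      Submodule.finiteDimensional_of_le inf_le_left
    have hrank : ∀ j ≤ l + 1, j ≤ Module.finrank K
        (relSpace q p t s m ⊓ midSupp K m (l + 1 - j) : Submodule K (ℕ → K)) := by
      intro j
      induction j with
      | zero => exact fun _ => Nat.zero_le _
      | succ j ih =>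
        intro hj
        refine lt_of_le_of_lt (ih (by omega)) ?_
        have hfd' := hfd (l + 1 - (j + 1))
        apply Submodule.finrank_lt_finrank_of_lt
        obtain ⟨c, hc, hcs, hlm, htop⟩ := hdown j (by omega)
        rw [show l + 1 - (j + 1) = l - j by omega, show l + 1 - j = l - j + 1 by omega]
        refine lt_of_le_of_ne (inf_le_inf_left _ fun d hd a ha => hd a (by omega)) fun heq => ?_
        have hmem : c ∈ relSpace q p t s m ⊓ midSupp K m (l - j + 1) := heq ▸ ⟨hc, hcs⟩
        exact htop (hmem.2 _ (by omega))
    have h0 := hrank (l + 1) le_rfl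
    rw [Nat.sub_self] at h0
    exact lt_of_lt_of_le h0 (Submodule.finrank_mono inf_le_left)
  · intro h
    by_contra hno
    have hbot := relSpace_inf_midSupp_eq_bot hq ht hβ hno
    let f : relSpace q p t s m →ₗ[K] (Fin l → K) :=
      (LinearMap.pi fun i : Fin l => LinearMap.proj (m - i : ℕ)) ∘ₗ (relSpace q p t s m).subtype
    have hf : Function.Injective f := by
      rw [← LinearMap.ker_eq_bot, LinearMap.ker_eq_bot']
      intro c hc
      have hmid : ∀ i ≤ l, (c : ℕ → K) ∈ midSupp K m i := by
        intro i
        induction i with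
        | zero =>
          intro _ a ha
          exact relSpace_le_suppLE m c.2 a (by omega)
        | succ i ih =>
          intro hi
          exact mem_midSupp_succ_of_coeff_eq_zero hβ c.2 (ih (by omega)) (congrFun hc ⟨i, hi⟩)
      have : (c : ℕ → K) ∈ relSpace q p t s m ⊓ midSupp K m l := ⟨c.2, hmid l le_rfl⟩
      rw [hbot, Submodule.mem_bot] at this
      exact Subtype.ext this
    have := LinearMap.finrank_le_finrank_of_injective hf
    rw [Module.finrank_fin_fun] at this
    omega

end Leading

/-! ### Products of two iterated braided commutators -/

section Products

variable {K : Type*} [Field K] (Q : Fin 2 → Fin 2 → K)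

/-- The iterated braided commutator `u_j = (ad x_1)^j (x_2)` in the tensor algebra; the letters
`x_1, x_2` are indexed by `0, 1 : Fin 2`. -/
def adPow : ℕ → FreeAlgebra K (Fin 2)
  | 0 => FreeAlgebra.ι K 1
  | j + 1 => FreeAlgebra.ι K 0 * adPow j - (Q 0 0 ^ j * Q 0 1) • (adPow j * FreeAlgebra.ι K 0)

theorem adPow_zero : adPow Q 0 = FreeAlgebra.ι K 1 := rfl

theorem adPow_succ (j : ℕ) : adPow Q (j + 1) =
    FreeAlgebra.ι K 0 * adPow Q j - (Q 0 0 ^ j * Q 0 1) • (adPow Q j * FreeAlgebra.ι K 0) := rfl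

theorem cotwist_zero_adPow (j : ℕ) :
    cotwist Q 0 (adPow Q j) = (Q 0 0 ^ j * Q 1 0) • adPow Q j := by
  induction j with
  | zero => simp [adPow_zero]
  | succ j ih =>
    rw [adPow_succ, map_sub, map_smul, map_mul, map_mul, ih, cotwist_ι]
    simp only [smul_mul_assoc, mul_smul_comm, smul_smul, smul_sub]
    congr 2 <;> ring

theorem cotwist_one_adPow (j : ℕ) :
    cotwist Q 1 (adPow Q j) = (Q 0 1 ^ j * Q 1 1) • adPow Q j := by
  induction j with
  | zero => simp [adPow_zero]
  | succ j ih =>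
    rw [adPow_succ, map_sub, map_smul, map_mul, map_mul, ih, cotwist_ι]
    simp only [smul_mul_assoc, mul_smul_comm, smul_smul, smul_sub]
    congr 2 <;> ring

theorem skewDer_zero_adPow_zero : skewDer Q 0 (adPow Q 0) = 0 := by
  simp [adPow_zero]

theorem skewDer_zero_adPow_succ (j : ℕ) :
    skewDer Q 0 (adPow Q (j + 1)) = lowCoeff (Q 0 0) (Q 0 1 * Q 1 0) (j + 1) • adPow Q j := by
  have hstep : ∀ j, skewDer Q 0 (adPow Q (j + 1)) =
      adPow Q j + Q 0 0 • (FreeAlgebra.ι K 0 * skewDer Q 0 (adPow Q j)) -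
        (Q 0 0 ^ j * Q 0 1) • (skewDer Q 0 (adPow Q j) * FreeAlgebra.ι K 0 +
          (Q 0 0 ^ j * Q 1 0) • adPow Q j) := by
    intro j
    rw [adPow_succ, map_sub, map_smul, skewDer_ι_mul, skewDer_mul, cotwist_zero_adPow]
    simp
  induction j with
  | zero =>
    rw [hstep, skewDer_zero_adPow_zero]
    simp only [lowCoeff, mul_zero, zero_mul, smul_zero, add_zero, zero_add, pow_zero, one_mul,
      smul_smul, sub_smul, one_smul]
  | succ j ih =>
    rw [hstep, ih]
    conv_rhs => rw [lowCoeff, add_smul, mul_smul, smul_comm]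
    rw [adPow_succ Q j]
    simp only [smul_mul_assoc, mul_smul_comm, smul_smul, smul_sub, smul_add, sub_smul, one_smul,
      sub_mul]
    module

theorem skewDer_one_adPow_zero : skewDer Q 1 (adPow Q 0) = 1 := by
  simp [adPow_zero]

theorem skewDer_one_adPow_succ (j : ℕ) : skewDer Q 1 (adPow Q (j + 1)) = 0 := by
  induction j with
  | zero =>
    rw [adPow_succ, map_sub, map_smul, skewDer_ι_mul, skewDer_mul, skewDer_one_adPow_zero]
    simp
  | succ j ih =>
    rw [adPow_succ, map_sub, map_smul, skewDer_ι_mul, skewDer_mul, ih]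
    simp

theorem counit_adPow (j : ℕ) : counit K 2 (adPow Q j) = 0 := by
  induction j with
  | zero => simp [adPow_zero]
  | succ j ih => simp [adPow_succ]

/-- If `β_1, …, β_j` are nonzero, then `u_j` is nonzero in the Nichols algebra. -/
theorem adPow_notMem_radical (j : ℕ)
    (hβ : ∀ i < j, lowCoeff (Q 0 0) (Q 0 1 * Q 1 0) (i + 1) ≠ 0) : adPow Q j ∉ radical Q := by
  induction j with
  | zero =>
    intro h
    have := h [1]
    simp [adPow_zero] at this
  | succ j ih =>
    intro h
    refine ih (fun i hi => hβ i (by omega)) ?_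
    have := (mem_radical_iff.1 h).2 0
    rw [skewDer_zero_adPow_succ] at this
    have h2 := ((radical Q).restrictScalars K).smul_mem
      (lowCoeff (Q 0 0) (Q 0 1 * Q 1 0) (j + 1))⁻¹ this
    rwa [smul_smul, inv_mul_cancel₀ (hβ j (by omega)), one_smul] at h2

/-- The element `∑ c_a u_a u_{m - a}` of the tensor algebra. -/
def quadSum (m : ℕ) : (ℕ → K) →ₗ[K] FreeAlgebra K (Fin 2) where
  toFun c := ∑ x ∈ Finset.HasAntidiagonal.antidiagonal m, c x.1 • (adPow Q x.1 * adPow Q x.2)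
  map_add' c d := by simp [add_smul, Finset.sum_add_distrib]
  map_smul' r c := by simp [mul_smul, Finset.smul_sum]

theorem quadSum_apply (m : ℕ) (c : ℕ → K) :
    quadSum Q m c = ∑ x ∈ Finset.HasAntidiagonal.antidiagonal m, c x.1 • (adPow Q x.1 * adPow Q x.2) := rfl

theorem quadSum_single (a b : ℕ) : quadSum Q (a + b) (Pi.single a 1) = adPow Q a * adPow Q b := by
  rw [quadSum_apply, Finset.sum_eq_single (a, b)]
  · simp
  · rintro ⟨x, y⟩ hxy hne
    have : x ≠ a := by
      rintro rfl
      rw [Finset.HasAntidiagonal.mem_antidiagonal] at hxy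
      exact hne (by rw [Prod.mk.injEq]; exact ⟨rfl, by omega⟩)
    simp [this]
  · simp

theorem skewDer_zero_quadSum_zero (c : ℕ → K) : skewDer Q 0 (quadSum Q 0 c) = 0 := by
  simp [quadSum_apply, skewDer_mul, skewDer_zero_adPow_zero]

theorem skewDer_zero_quadSum_succ (m : ℕ) (c : ℕ → K) :
    skewDer Q 0 (quadSum Q (m + 1) c) =
      quadSum Q m (lowerOp (Q 0 0) (Q 0 1) (Q 1 0) (m + 1) c) := by
  simp only [quadSum_apply, map_sum, map_smul, skewDer_mul, smul_add, Finset.sum_add_distrib]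
  rw [Finset.Nat.sum_antidiagonal_succ, Finset.Nat.sum_antidiagonal_succ', skewDer_zero_adPow_zero,
    zero_mul, smul_zero, zero_add, mul_zero, smul_zero, zero_add, ← Finset.sum_add_distrib]
  refine Finset.sum_congr rfl fun x hx => ?_
  rw [Finset.HasAntidiagonal.mem_antidiagonal] at hx
  rw [skewDer_zero_adPow_succ, skewDer_zero_adPow_succ, cotwist_zero_adPow, lowerOp_apply,
    show m + 1 - x.1 = x.2 + 1 by omega]
  simp only [smul_mul_assoc, mul_smul_comm, smul_smul, ← add_smul]
  congr 1
  ring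

theorem skewDer_one_quadSum (m : ℕ) (c : ℕ → K) :
    skewDer Q 1 (quadSum Q m c) = endFunctional (Q 0 1) (Q 1 1) m c • adPow Q m := by
  simp only [quadSum_apply, map_sum, map_smul, skewDer_mul, smul_add, Finset.sum_add_distrib]
  rw [endFunctional_apply, add_smul]
  congr 1
  · cases m with
    | zero => simp [skewDer_one_adPow_zero]
    | succ m =>
      rw [Finset.Nat.sum_antidiagonal_succ]
      simp [skewDer_one_adPow_succ, skewDer_one_adPow_zero]
  · cases m with
    | zero =>
      simp [skewDer_one_adPow_zero, cotwist_one_adPow, smul_smul, mul_comm]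
    | succ m =>
      rw [Finset.Nat.sum_antidiagonal_succ']
      simp [skewDer_one_adPow_succ, skewDer_one_adPow_zero, cotwist_one_adPow, smul_smul,
        mul_comm]

variable {Q}

theorem quadSum_mem_radical_iff {m : ℕ}
    (hβ : ∀ i < m, lowCoeff (Q 0 0) (Q 0 1 * Q 1 0) (i + 1) ≠ 0) {c : ℕ → K}
    (hc : c ∈ suppLE K m) :
    quadSum Q m c ∈ radical Q ↔ c ∈ relSpace (Q 0 0) (Q 0 1) (Q 1 0) (Q 1 1) m := by
  have hcounit : ∀ m (c : ℕ → K), counit K 2 (quadSum Q m c) = 0 := by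
    intro m c
    simp [quadSum_apply, counit_adPow]
  have hend : ∀ m (c : ℕ → K), (∀ i < m, lowCoeff (Q 0 0) (Q 0 1 * Q 1 0) (i + 1) ≠ 0) →
      (skewDer Q 1 (quadSum Q m c) ∈ radical Q ↔ endFunctional (Q 0 1) (Q 1 1) m c = 0) := by
    intro m c hβ
    rw [skewDer_one_quadSum]
    constructor
    · intro h
      by_contra hne
      have h2 := ((radical Q).restrictScalars K).smul_mem
        (endFunctional (Q 0 1) (Q 1 1) m c)⁻¹ h
      rw [smul_smul, inv_mul_cancel₀ hne, one_smul] at h2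
      exact adPow_notMem_radical Q m hβ h2
    · intro h
      rw [h, zero_smul]
      exact zero_mem _
  induction m generalizing c with
  | zero =>
    rw [mem_relSpace_zero, mem_radical_iff, Fin.forall_fin_two, hend 0 c hβ,
      skewDer_zero_quadSum_zero]
    simp [hcounit, hc]
  | succ m ih =>
    have hD : lowerOp (Q 0 0) (Q 0 1) (Q 1 0) (m + 1) c ∈ suppLE K m := by
      intro a ha
      rw [lowerOp_apply, hc (a + 1) (by omega), mul_zero, zero_add]
      rcases Nat.lt_or_ge (m + 1) a with h | h
      · rw [hc a h, mul_zero]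
      · rw [show m + 1 - a = 0 by omega, lowCoeff, mul_zero, zero_mul]
    have hiff := ih (fun i hi => hβ i (by omega)) hD
    rw [mem_relSpace_succ, mem_radical_iff, Fin.forall_fin_two, hend _ c hβ,
      skewDer_zero_quadSum_succ, propext hiff]
    simp only [hcounit, hc, true_and]
    exact and_comm

/-- The braided commutator with `x_1` acts on the elements `∑ c_a u_a u_{m - a}` by the raising
operator. -/
theorem quadSum_raiseOp {m : ℕ} {c : ℕ → K} (hc : c ∈ suppLE K m) :
    FreeAlgebra.ι K 0 * quadSum Q m c -
        (Q 0 0 ^ m * Q 0 1 ^ 2) • (quadSum Q m c * FreeAlgebra.ι K 0) =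
      quadSum Q (m + 1) (raiseOp (Q 0 0) (Q 0 1) c) := by
  have hterm : ∀ x ∈ Finset.HasAntidiagonal.antidiagonal m,
      FreeAlgebra.ι K 0 * (c x.1 • (adPow Q x.1 * adPow Q x.2)) -
        (Q 0 0 ^ m * Q 0 1 ^ 2) • ((c x.1 • (adPow Q x.1 * adPow Q x.2)) * FreeAlgebra.ι K 0) =
      c x.1 • (adPow Q (x.1 + 1) * adPow Q x.2) +
        (Q 0 0 ^ x.1 * Q 0 1 * c x.1) • (adPow Q x.1 * adPow Q (x.2 + 1)) := by
    intro x hx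
    rw [Finset.HasAntidiagonal.mem_antidiagonal] at hx
    rw [adPow_succ, adPow_succ, ← hx]
    simp only [smul_mul_assoc, mul_smul_comm, mul_sub, sub_mul, smul_sub, mul_assoc, smul_smul]
    rw [pow_add]
    module
  have hsplit : quadSum Q (m + 1) (raiseOp (Q 0 0) (Q 0 1) c) =
      ∑ x ∈ Finset.HasAntidiagonal.antidiagonal (m + 1), ((match x.1 with | 0 => 0 | a + 1 => c a : K) •
        (adPow Q x.1 * adPow Q x.2)) +
      ∑ x ∈ Finset.HasAntidiagonal.antidiagonal (m + 1), (Q 0 0 ^ x.1 * Q 0 1 * c x.1) •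
        (adPow Q x.1 * adPow Q x.2) := by
    rw [← Finset.sum_add_distrib, quadSum_apply]
    exact Finset.sum_congr rfl fun x _ => by rw [← add_smul]; rfl
  rw [hsplit, Finset.Nat.sum_antidiagonal_succ, Finset.Nat.sum_antidiagonal_succ',
    hc (m + 1) (by omega), quadSum_apply, Finset.mul_sum, Finset.sum_mul, Finset.smul_sum,
    ← Finset.sum_sub_distrib, Finset.sum_congr rfl hterm, Finset.sum_add_distrib]
  simp

theorem adPow_mem_homog (j : ℕ) : adPow Q j ∈ homog K ![j, 1] := by
  have h0 : FreeAlgebra.ι K (0 : Fin 2) ∈ homog K ![1, 0] :=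
    Submodule.subset_span ⟨[0], by ext i; fin_cases i <;> simp [wordDeg], by simp [monom]⟩
  induction j with
  | zero =>
    exact Submodule.subset_span ⟨[1], by ext i; fin_cases i <;> simp [wordDeg],
      by simp [monom, adPow_zero]⟩
  | succ j ih =>
    rw [adPow_succ]
    refine sub_mem ?_ (Submodule.smul_mem _ _ ?_)
    · have := mul_mem_homog h0 ih
      rwa [show (![1, 0] + ![j, 1] : Fin 2 → ℕ) = ![j + 1, 1] by
        ext i; fin_cases i <;> simp [add_comm]] at this
    · have := mul_mem_homog ih h0
      rwa [show (![j, 1] + ![1, 0] : Fin 2 → ℕ) = ![j + 1, 1] by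
        ext i; fin_cases i <;> simp] at this

theorem quadSum_mem_homog (m : ℕ) (c : ℕ → K) : quadSum Q m c ∈ homog K ![m, 2] := by
  rw [quadSum_apply]
  refine sum_mem fun x hx => Submodule.smul_mem _ _ ?_
  rw [Finset.HasAntidiagonal.mem_antidiagonal] at hx
  have := mul_mem_homog (adPow_mem_homog (Q := Q) x.1) (adPow_mem_homog (Q := Q) x.2)
  rwa [show (![x.1, 1] + ![x.2, 1] : Fin 2 → ℕ) = ![m, 2] by
    ext i; fin_cases i <;> simp [hx]] at this

end Products

/-! ### Lyndon words with at most two letters `x_2` -/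

section LyndonWords

/-- The word `x_1 ^ a x_2`. -/
def oneWord (a : ℕ) : List (Fin 2) := List.replicate a 0 ++ [1]

/-- The word `x_1 ^ a x_2 x_1 ^ b x_2`. -/
def twoWord (a b : ℕ) : List (Fin 2) := List.replicate a 0 ++ 1 :: oneWord b

theorem oneWord_succ (a : ℕ) : oneWord (a + 1) = 0 :: oneWord a := rfl

theorem twoWord_succ (a b : ℕ) : twoWord (a + 1) b = 0 :: twoWord a b := rfl

theorem twoWord_eq_append (a b : ℕ) : twoWord a b = oneWord a ++ oneWord b := by
  simp [twoWord, oneWord]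

theorem length_oneWord (a : ℕ) : (oneWord a).length = a + 1 := by simp [oneWord]

theorem length_twoWord (a b : ℕ) : (twoWord a b).length = a + b + 2 := by
  simp [twoWord, oneWord]; omega

theorem count_zero_oneWord (a : ℕ) : (oneWord a).count 0 = a := by simp [oneWord]

theorem count_one_oneWord (a : ℕ) : (oneWord a).count 1 = 1 := by
  simp [oneWord, List.count_replicate]

theorem count_zero_twoWord (a b : ℕ) : (twoWord a b).count 0 = a + b := by
  rw [twoWord_eq_append, List.count_append, count_zero_oneWord, count_zero_oneWord]

theorem count_one_twoWord (a b : ℕ) : (twoWord a b).count 1 = 2 := by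
  rw [twoWord_eq_append, List.count_append, count_one_oneWord, count_one_oneWord]

theorem replicate_append_lt_iff (a b : ℕ) (x y : List (Fin 2)) :
    List.replicate a 0 ++ 1 :: x < List.replicate b 0 ++ 1 :: y ↔ b < a ∨ (a = b ∧ x < y) := by
  induction a generalizing b with
  | zero =>
    cases b with
    | zero => simp
    | succ b => simp [List.replicate_succ, List.cons_lt_cons_iff]
  | succ a ih =>
    cases b with
    | zero => simp [List.replicate_succ, List.cons_lt_cons_iff]
    | succ b => simp [List.replicate_succ, ih]

theorem oneWord_lt_oneWord {a b : ℕ} : oneWord a < oneWord b ↔ b < a := by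
  rw [oneWord, oneWord, replicate_append_lt_iff]
  simp

theorem twoWord_lt_oneWord {a b c : ℕ} : twoWord a b < oneWord c ↔ c < a := by
  change List.replicate a 0 ++ 1 :: oneWord b < List.replicate c 0 ++ 1 :: [] ↔ _
  rw [replicate_append_lt_iff]
  simp

theorem twoWord_lt_twoWord {a b c d : ℕ} :
    twoWord a b < twoWord c d ↔ c < a ∨ (a = c ∧ d < b) := by
  rw [twoWord, twoWord, replicate_append_lt_iff, oneWord_lt_oneWord]

theorem replicate_lt_replicate_append (a b : ℕ) (x : List (Fin 2)) (hab : a ≤ b) :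
    List.replicate a 0 < List.replicate b 0 ++ 1 :: x := by
  induction a generalizing b with
  | zero => cases b <;> simp [List.replicate_succ]
  | succ a ih =>
    obtain ⟨b, rfl⟩ := Nat.exists_eq_succ_of_ne_zero (by omega : b ≠ 0)
    simp only [Nat.succ_eq_add_one, List.replicate_succ, List.cons_append,
      List.cons_lt_cons_iff]
    exact Or.inr ⟨trivial, ih b (by omega)⟩

theorem replicate_lt_replicate_append_of_lt (a b : ℕ) (x : List (Fin 2)) (hab : b < a) :
    List.replicate a 0 < List.replicate b 0 ++ 1 :: x := by
  induction b generalizing a with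
  | zero =>
    obtain ⟨a, rfl⟩ := Nat.exists_eq_succ_of_ne_zero (by omega : a ≠ 0)
    simp [List.replicate_succ, List.cons_lt_cons_iff]
  | succ b ih =>
    obtain ⟨a, rfl⟩ := Nat.exists_eq_succ_of_ne_zero (by omega : a ≠ 0)
    simp only [Nat.succ_eq_add_one, List.replicate_succ, List.cons_append,
      List.cons_lt_cons_iff]
    exact Or.inr ⟨trivial, ih a (by omega)⟩

theorem not_twoWord_lt_replicate (a b c : ℕ) : ¬ twoWord a b < List.replicate c 0 := by
  rcases le_or_gt c a with h | h
  · exact lt_asymm (replicate_lt_replicate_append c a _ h)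
  · exact lt_asymm (replicate_lt_replicate_append_of_lt c a _ h)

theorem eq_replicate_of_count_one {w : List (Fin 2)} (h : w.count 1 = 0) :
    w = List.replicate w.length 0 := by
  rw [List.eq_replicate_iff]
  refine ⟨rfl, fun x hx => ?_⟩
  rw [List.count_eq_zero] at h
  fin_cases x
  · rfl
  · exact absurd hx h

theorem exists_eq_replicate_append_of_count_one {w : List (Fin 2)} {c : ℕ}
    (h : w.count 1 = c + 1) :
    ∃ a w', w = List.replicate a 0 ++ 1 :: w' ∧ w'.count 1 = c := by
  induction w with
  | nil => simp at h
  | cons x w ih =>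
    fin_cases x
    · obtain ⟨a, w', rfl, hw'⟩ := ih (by simpa using h)
      exact ⟨a + 1, w', rfl, hw'⟩
    · exact ⟨0, w, rfl, by simpa using h⟩

theorem eq_of_oneWord_eq_append {a : ℕ} {w v : List (Fin 2)} (h : oneWord a = w ++ v)
    (hv : v ≠ []) : ∃ b, b + w.length = a ∧ v = oneWord b := by
  induction w generalizing a with
  | nil => exact ⟨a, rfl, h.symm⟩
  | cons x w ih =>
    cases a with
    | zero => simp [oneWord, hv] at h
    | succ a =>
      rw [oneWord_succ, List.cons_append, List.cons.injEq] at h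
      obtain ⟨b, hb, rfl⟩ := ih h.2
      exact ⟨b, by rw [List.length_cons]; omega, rfl⟩

theorem eq_of_twoWord_eq_append {a b : ℕ} {w v : List (Fin 2)} (h : twoWord a b = w ++ v)
    (hv : v ≠ []) :
    (∃ c, c + w.length = a ∧ v = twoWord c b) ∨
      ∃ c, c + w.length = a + 1 + b ∧ c ≤ b ∧ v = oneWord c := by
  induction w generalizing a with
  | nil => exact Or.inl ⟨a, rfl, h.symm⟩
  | cons x w ih =>
    cases a with
    | zero =>
      rw [twoWord, List.replicate_zero, List.nil_append, List.cons_append, List.cons.injEq] at h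
      obtain ⟨c, hc, rfl⟩ := eq_of_oneWord_eq_append h.2 hv
      exact Or.inr ⟨c, by rw [List.length_cons]; omega, by omega, rfl⟩
    | succ a =>
      rw [twoWord_succ, List.cons_append, List.cons.injEq] at h
      rcases ih h.2 with ⟨c, hc, rfl⟩ | ⟨c, hc, hcb, rfl⟩
      · exact Or.inl ⟨c, by rw [List.length_cons]; omega, rfl⟩
      · exact Or.inr ⟨c, by rw [List.length_cons]; omega, hcb, rfl⟩

theorem isLyndon_oneWord (a : ℕ) : IsLyndon (oneWord a) := by
  refine ⟨by simp [oneWord], fun w v h hw hv => ?_⟩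
  obtain ⟨b, hb, rfl⟩ := eq_of_oneWord_eq_append h hv
  have := List.length_pos_of_ne_nil hw
  rw [oneWord, oneWord, List.append_assoc, List.singleton_append, replicate_append_lt_iff]
  exact Or.inl (by omega)

theorem isLyndon_twoWord {a b : ℕ} (hab : b < a) : IsLyndon (twoWord a b) := by
  refine ⟨by simp [twoWord], fun w v h hw hv => ?_⟩
  have := List.length_pos_of_ne_nil hw
  rcases eq_of_twoWord_eq_append h hv with ⟨c, hc, rfl⟩ | ⟨c, hc, hcb, rfl⟩
  · rw [twoWord, twoWord, List.append_assoc, List.cons_append, replicate_append_lt_iff]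
    exact Or.inl (by omega)
  · rw [twoWord, oneWord, oneWord, List.append_assoc, List.singleton_append,
      replicate_append_lt_iff]
    exact Or.inl (by omega)

theorem IsLyndon.eq_oneWord {u : List (Fin 2)} (hu : IsLyndon u) (h : u.count 1 = 1) :
    ∃ a, u = oneWord a := by
  obtain ⟨a, w, rfl, hw⟩ := exists_eq_replicate_append_of_count_one h
  obtain ⟨b, rfl⟩ : ∃ b, w = List.replicate b 0 := ⟨_, eq_replicate_of_count_one hw⟩
  cases b with
  | zero => exact ⟨a, rfl⟩
  | succ b =>
    have h := hu.2 (List.replicate a 0 ++ [1]) (List.replicate (b + 1) 0) (by simp) (by simp)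
      (by simp)
    rw [← List.append_assoc, List.replicate_append_replicate, replicate_append_lt_iff] at h
    omega

theorem IsLyndon.eq_twoWord {u : List (Fin 2)} (hu : IsLyndon u) (h : u.count 1 = 2) :
    ∃ a b, b < a ∧ u = twoWord a b := by
  obtain ⟨a, w, rfl, hw⟩ := exists_eq_replicate_append_of_count_one h
  obtain ⟨b, w', rfl, hw'⟩ := exists_eq_replicate_append_of_count_one hw
  obtain ⟨c, rfl⟩ : ∃ c, w' = List.replicate c 0 := ⟨_, eq_replicate_of_count_one hw'⟩
  cases c with
  | zero =>
    refine ⟨a, b, ?_, rfl⟩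
    have h := hu.2 (oneWord a) (oneWord b) (by simp [oneWord]) (by simp [oneWord])
      (by simp [oneWord])
    rw [← twoWord_eq_append] at h
    have h' : twoWord a b < twoWord b a := h
    rw [twoWord_lt_twoWord] at h'
    omega
  | succ c =>
    have h := hu.2 (twoWord a b) (List.replicate (c + 1) 0) (by simp [twoWord, oneWord])
      (by simp [twoWord]) (by simp)
    rw [twoWord, ← List.append_assoc, List.replicate_append_replicate,
      replicate_append_lt_iff] at h
    have h2 : ¬ c + 1 + a < a := by omega
    have h3 : a ≠ c + 1 + a := by omega
    tauto

theorem not_isLyndon_twoWord_self (a : ℕ) : ¬ IsLyndon (twoWord a a) := by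
  intro h
  have := h.2 (oneWord a) (oneWord a) (twoWord_eq_append a a) (by simp [oneWord])
    (by simp [oneWord])
  rw [← twoWord_eq_append] at this
  exact lt_irrefl _ this

theorem isLyndon_singleton {n : ℕ} (i : Fin n) : IsLyndon [i] := by
  refine ⟨by simp, fun w v h hw hv => ?_⟩
  have h1 := List.length_pos_of_ne_nil hw
  have h2 := List.length_pos_of_ne_nil hv
  have := congrArg List.length h
  simp at this
  omega

theorem not_isLyndon_replicate {a : ℕ} (ha : 2 ≤ a) :
    ¬ IsLyndon (List.replicate a (0 : Fin 2)) := by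
  intro h
  obtain ⟨a, rfl⟩ := Nat.exists_eq_add_of_le ha
  have := h.2 (List.replicate 1 0) (List.replicate (1 + a) 0)
    (by rw [List.replicate_append_replicate]; congr 1; omega) (by simp) (by simp)
  rw [List.replicate_append_replicate, show 1 + a + 1 = 2 + a by omega] at this
  exact lt_irrefl _ this

theorem shirshowIndex_eq {u : List (Fin 2)} {i : ℕ} (h0 : 0 < i) (hi : i < u.length)
    (h1 : IsLyndon (u.take i)) (h2 : IsLyndon (u.drop i))
    (hmin : ∀ j, 0 < j → j < i → ¬ (IsLyndon (u.take j) ∧ IsLyndon (u.drop j))) :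
    shirshowIndex u = i := by
  refine le_antisymm (Nat.sInf_le ⟨h0, hi, h1, h2⟩) ?_
  by_contra hlt
  rw [not_le] at hlt
  obtain ⟨h0', _, h⟩ := Nat.sInf_mem (s := {i | 0 < i ∧ i < u.length ∧ IsLyndon (u.take i) ∧
    IsLyndon (u.drop i)}) ⟨i, h0, hi, h1, h2⟩
  exact hmin _ h0' hlt h

theorem shirshowIndex_oneWord_succ (a : ℕ) : shirshowIndex (oneWord (a + 1)) = 1 :=
  shirshowIndex_eq one_pos (by rw [length_oneWord]; omega) (isLyndon_singleton 0)
    (isLyndon_oneWord a) (by omega)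

theorem shirshowIndex_twoWord_succ {a b : ℕ} (hab : b < a) :
    shirshowIndex (twoWord (a + 1) b) = 1 :=
  shirshowIndex_eq one_pos (by rw [length_twoWord]; omega) (isLyndon_singleton 0)
    (isLyndon_twoWord hab) (by omega)

theorem take_twoWord (a b : ℕ) : (twoWord a b).take (a + 1) = oneWord a := by
  rw [twoWord_eq_append]
  exact List.take_left' (length_oneWord a)

theorem drop_twoWord (a b : ℕ) : (twoWord a b).drop (a + 1) = oneWord b := by
  rw [twoWord_eq_append]
  exact List.drop_left' (length_oneWord a)

theorem shirshowIndex_twoWord_self (b : ℕ) : shirshowIndex (twoWord (b + 1) b) = b + 2 := by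
  refine shirshowIndex_eq (by omega) (by rw [length_twoWord]; omega) ?_ ?_ ?_
  · rw [take_twoWord]
    exact isLyndon_oneWord _
  · rw [drop_twoWord]
    exact isLyndon_oneWord _
  · rintro j h0 hj ⟨h1, h2⟩
    have htake : (twoWord (b + 1) b).take j = List.replicate j 0 := by
      rw [twoWord, List.take_append_of_le_length (by simp; omega), List.take_replicate]
      congr 1
      omega
    rw [htake] at h1
    have hj1 : j = 1 := by
      by_contra hne
      exact not_isLyndon_replicate (by omega) h1
    subst hj1
    exact not_isLyndon_twoWord_self b h2

end LyndonWords

/-! ### Super-letters of degree at most two in `x_2` -/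

section SuperLetters

variable {K : Type*} [Field K] (Q : Fin 2 → Fin 2 → K)

theorem bichar_wordDeg (v w : List (Fin 2)) : bichar Q (wordDeg v) (wordDeg w) =
    Q 0 0 ^ (v.count 0 * w.count 0) * Q 0 1 ^ (v.count 0 * w.count 1) *
      (Q 1 0 ^ (v.count 1 * w.count 0) * Q 1 1 ^ (v.count 1 * w.count 1)) := by
  simp [bichar, wordDeg, Fin.prod_univ_two]

theorem superLetter_eq {u : List (Fin 2)} {i : ℕ} (hi : shirshowIndex u = i) (h0 : 0 < i)
    (hlen : i < u.length) :
    superLetter Q u = superLetter Q (u.take i) * superLetter Q (u.drop i) -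
      bichar Q (wordDeg (u.take i)) (wordDeg (u.drop i)) •
        (superLetter Q (u.drop i) * superLetter Q (u.take i)) := by
  subst hi
  rw [superLetter, dif_pos ⟨h0, hlen⟩]

theorem superLetter_singleton (i : Fin 2) :
    superLetter Q [i] = toNichols Q (FreeAlgebra.ι K i) := by
  rw [superLetter, dif_neg (by rw [List.length_singleton]; omega), monom]
  simp

theorem superLetter_oneWord (a : ℕ) :
    superLetter Q (oneWord a) = toNichols Q (adPow Q a) := by
  induction a with
  | zero => exact superLetter_singleton Q 1
  | succ a ih =>
    rw [superLetter_eq Q (shirshowIndex_oneWord_succ a) one_pos (by rw [length_oneWord]; omega)]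
    have h1 : (oneWord (a + 1)).take 1 = [0] := rfl
    have h2 : (oneWord (a + 1)).drop 1 = oneWord a := rfl
    rw [h1, h2, ih, superLetter_singleton, bichar_wordDeg, count_zero_oneWord, count_one_oneWord,
      adPow_succ, map_sub, toNichols_smul, map_mul, map_mul]
    simp

/-- The super-letter of `x_1 ^ a x_2 x_1 ^ b x_2` is the braided commutator of `u_a` and `u_b` up
to products `u_x u_y` with `b < x, y < a`. -/
theorem exists_superLetter_twoWord {a b : ℕ} (hab : b < a) :
    ∃ c ∈ midSupp K (a + b) b, c a = 1 ∧
      c b = -(Q 0 0 ^ (a * b) * Q 0 1 ^ a * Q 1 0 ^ b * Q 1 1) ∧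
      superLetter Q (twoWord a b) = toNichols Q (quadSum Q (a + b) c) := by
  induction a, hab using Nat.le_induction with
  | base =>
    refine ⟨Pi.single (b + 1) 1 -
      (Q 0 0 ^ ((b + 1) * b) * Q 0 1 ^ (b + 1) * Q 1 0 ^ b * Q 1 1) • Pi.single b 1,
      ?_, ?_, ?_, ?_⟩
    · intro x hx
      have h1 : x ≠ b := by omega
      have h2 : x ≠ b + 1 := by omega
      simp [h1, h2]
    · simp
    · simp
    · rw [superLetter_eq Q (shirshowIndex_twoWord_self b) (by omega)
        (by rw [length_twoWord]; omega), take_twoWord, drop_twoWord, superLetter_oneWord,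
        superLetter_oneWord, bichar_wordDeg, map_sub, map_smul, quadSum_single, add_comm (b + 1) b,
        quadSum_single, map_sub, toNichols_smul, map_mul, map_mul]
      simp only [count_zero_oneWord, count_one_oneWord]
      congr 2
      simp
      ring
  | succ a hab ih =>
    obtain ⟨c, hc, hca, hcb, hs⟩ := ih
    have hsupp : c ∈ suppLE K (a + b) := fun x hx => hc x (by omega)
    refine ⟨raiseOp (Q 0 0) (Q 0 1) c, ?_, ?_, ?_, ?_⟩
    · rw [add_right_comm]
      exact raiseOp_mem_midSupp hc
    · rw [raiseOp_succ, hca, hc (a + 1) (by omega)]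
      simp
    · cases b with
      | zero =>
        rw [raiseOp_zero, hcb]
        simp
        ring
      | succ b =>
        rw [raiseOp_succ, hc b (by omega), hcb]
        ring
    · rw [superLetter_eq Q (shirshowIndex_twoWord_succ hab) one_pos
        (by rw [length_twoWord]; omega)]
      have h1 : (twoWord (a + 1) b).take 1 = [0] := rfl
      have h2 : (twoWord (a + 1) b).drop 1 = twoWord a b := rfl
      rw [h1, h2, hs, superLetter_singleton, bichar_wordDeg, count_zero_twoWord,
        count_one_twoWord, add_right_comm a 1 b, ← quadSum_raiseOp hsupp, map_sub, toNichols_smul,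
        map_mul, map_mul]
      simp

theorem exists_mem_homog_superLetter (u : List (Fin 2)) :
    ∃ y ∈ homog K (wordDeg u), toNichols Q y = superLetter Q u := by
  induction hlen : u.length using Nat.strong_induction_on generalizing u with
  | _ N ih =>
    by_cases h : 0 < shirshowIndex u ∧ shirshowIndex u < u.length
    · obtain ⟨y, hy, hys⟩ := ih _ (by simp [List.length_take]; omega)
        (u.take (shirshowIndex u)) rfl
      obtain ⟨z, hz, hzs⟩ := ih _ (by simp [List.length_drop]; omega)
        (u.drop (shirshowIndex u)) rfl
      have hdeg : wordDeg u = wordDeg (u.take (shirshowIndex u)) +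
          wordDeg (u.drop (shirshowIndex u)) := by
        rw [← wordDeg_append, List.take_append_drop]
      refine ⟨y * z - bichar Q (wordDeg (u.take (shirshowIndex u)))
        (wordDeg (u.drop (shirshowIndex u))) • (z * y), ?_, ?_⟩
      · refine sub_mem ?_ (Submodule.smul_mem _ _ ?_)
        · rw [hdeg]
          exact mul_mem_homog hy hz
        · rw [hdeg, add_comm]
          exact mul_mem_homog hz hy
      · rw [superLetter_eq Q rfl h.1 h.2, map_sub, toNichols_smul, map_mul, map_mul, hys, hzs]
    · exact ⟨monom K u, monom_mem_homog u, by rw [superLetter, dif_neg h]⟩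

end SuperLetters

/-! ### Monomials in larger root vector candidates -/

section LargerMonomials

variable {K : Type*} [Field K] {Q : Fin 2 → Fin 2 → K}

theorem wordPow_one {n : ℕ} (v : List (Fin n)) : wordPow v 1 = v := by simp [wordPow]

theorem wordPow_two {n : ℕ} (v : List (Fin n)) : wordPow v 2 = v ++ v := by
  simp [wordPow, List.replicate_succ]

theorem count_wordPow {n : ℕ} (v : List (Fin n)) (e : ℕ) (i : Fin n) :
    (wordPow v e).count i = e * v.count i := by
  induction e with
  | zero => simp [wordPow]
  | succ e ih =>
    rw [wordPow, List.replicate_succ, List.flatten_cons, List.count_append, ← wordPow, ih]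
    ring

variable (Q) in
/-- The root vector candidate given by a Lyndon word. -/
def lyndonCandidate {u : List (Fin 2)} (hu : IsLyndon u) : Candidate Q :=
  ⟨u, 1, hu, Or.inl rfl⟩

theorem lyndonCandidate_word {u : List (Fin 2)} (hu : IsLyndon u) :
    (lyndonCandidate Q hu).word = u := wordPow_one u

theorem lyndonCandidate_elt {u : List (Fin 2)} (hu : IsLyndon u) :
    (lyndonCandidate Q hu).elt = superLetter Q u := pow_one _

variable (Q) in
/-- The span in the Nichols algebra of the products `u_a u_b` with `a + b = m` and `l ≤ a, b`. -/
def midImage (m l : ℕ) : Submodule K (NicholsAlgebra Q) :=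
  (midSupp K m l).map (toNicholsLin Q ∘ₗ quadSum Q m)

theorem toNichols_quadSum_mem_midImage {m l : ℕ} {c : ℕ → K} (hc : c ∈ midSupp K m l) :
    toNichols Q (quadSum Q m c) ∈ midImage Q m l := ⟨c, hc, rfl⟩

theorem toNichols_adPow_mul_mem_midImage {m l a b : ℕ} (hab : a + b = m) (ha : l ≤ a)
    (hb : l ≤ b) : toNichols Q (adPow Q a * adPow Q b) ∈ midImage Q m l := by
  subst hab
  rw [← quadSum_single]
  refine toNichols_quadSum_mem_midImage fun x hx => ?_
  have : x ≠ a := by omega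
  simp [this]

theorem midImage_mono {m l l' : ℕ} (h : l ≤ l') : midImage Q m l' ≤ midImage Q m l :=
  Submodule.map_mono fun _ hc a ha => hc a (by omega)

theorem toNichols_adPow_mul_mem_span_of_le {k l a b : ℕ} (hab : a + b = k + l) (ha : l < a)
    (hle : a ≤ b) : toNichols Q (adPow Q a * adPow Q b) ∈
      Submodule.span K (largerMonomials Q (twoWord k l)) := by
  apply Submodule.subset_span
  rcases hle.lt_or_eq with h | rfl
  · refine ⟨[(lyndonCandidate Q (isLyndon_oneWord a), 1),
      (lyndonCandidate Q (isLyndon_oneWord b), 1)], ?_, ?_, ?_⟩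
    · simp [lyndonCandidate_word, oneWord_lt_oneWord, h]
    · simp only [List.mem_cons, List.not_mem_nil, or_false]
      rintro p (rfl | rfl)
      · rw [lyndonCandidate_word, twoWord_lt_oneWord]
        omega
      · rw [lyndonCandidate_word, twoWord_lt_oneWord]
        omega
    · simp [lyndonCandidate_elt, superLetter_oneWord]
  · refine ⟨[(lyndonCandidate Q (isLyndon_oneWord a), 2)], by simp, ?_, ?_⟩
    · simp only [List.mem_cons, List.not_mem_nil, or_false]
      rintro p rfl
      rw [lyndonCandidate_word, twoWord_lt_oneWord]
      omega
    · simp [lyndonCandidate_elt, superLetter_oneWord, sq]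

theorem toNichols_adPow_mul_mem_span {k l : ℕ} (a b : ℕ) (hab : a + b = k + l) (ha : l < a)
    (hb : l < b) : toNichols Q (adPow Q a * adPow Q b) ∈
      Submodule.span K (largerMonomials Q (twoWord k l)) := by
  induction a using Nat.strong_induction_on generalizing b with
  | _ a ih =>
    rcases le_or_gt a b with h | h
    · exact toNichols_adPow_mul_mem_span_of_le hab ha h
    -- For `b < a`, the super-letter of `x_1 ^ a x_2 x_1 ^ b x_2` is used to reorder the product.
    obtain ⟨c, hc, hca, -, hs⟩ := exists_superLetter_twoWord Q h
    have hmem : toNichols Q (quadSum Q (a + b) c) ∈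
        Submodule.span K (largerMonomials Q (twoWord k l)) := by
      apply Submodule.subset_span
      refine ⟨[(lyndonCandidate Q (isLyndon_twoWord h), 1)], by simp, ?_, ?_⟩
      · simp only [List.mem_cons, List.not_mem_nil, or_false]
        rintro p rfl
        rw [lyndonCandidate_word, twoWord_lt_twoWord]
        omega
      · simp [lyndonCandidate_elt, hs]
    rw [quadSum_apply, ← Finset.add_sum_erase _ _
      (Finset.HasAntidiagonal.mem_antidiagonal.2 rfl : (a, b) ∈ _), hca, one_smul, map_add,
      Submodule.add_mem_iff_left] at hmem
    · exact hmem
    · rw [map_sum]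
      refine sum_mem fun x hx => ?_
      rw [Finset.mem_erase, Finset.HasAntidiagonal.mem_antidiagonal] at hx
      obtain ⟨x, y⟩ := x
      obtain ⟨hne, hxy⟩ := hx
      simp only at hxy
      rw [toNichols_smul]
      by_cases hx' : x < b ∨ a + b < x + b
      · rw [hc x hx', zero_smul]
        exact zero_mem _
      · have hxa : x ≠ a := by
          rintro rfl
          exact hne (by rw [Prod.mk.injEq]; exact ⟨rfl, by omega⟩)
        exact Submodule.smul_mem _ _ (ih x (by omega) y (by omega) (by omega) (by omega))

theorem midImage_le_span_largerMonomials (k l : ℕ) :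
    midImage Q (k + l) (l + 1) ≤ Submodule.span K (largerMonomials Q (twoWord k l)) := by
  rintro _ ⟨c, hc, rfl⟩
  rw [LinearMap.comp_apply, quadSum_apply, map_sum]
  refine sum_mem fun x hx => ?_
  rw [Finset.HasAntidiagonal.mem_antidiagonal] at hx
  rw [map_smul]
  by_cases h : x.1 < l + 1 ∨ k + l < x.1 + (l + 1)
  · rw [hc x.1 h, zero_smul]
    exact zero_mem _
  · exact Submodule.smul_mem _ _ (toNichols_adPow_mul_mem_span x.1 x.2 hx (by omega) (by omega))

theorem Candidate.exponent_pos (c : Candidate Q) : 0 < c.exponent := by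
  rcases c.exponent_mem with h | ⟨h, j, hj⟩
  · omega
  · rw [hj]
    exact Nat.mul_pos h (pow_pos (expChar_pos K _) j)

/-- The degree of a monomial in root vector candidates. -/
def listDeg (L : List (Candidate Q × ℕ)) : Fin 2 → ℕ :=
  (L.map fun p => (p.1.exponent * p.2) • wordDeg p.1.base).sum

theorem listDeg_cons (p : Candidate Q × ℕ) (L : List (Candidate Q × ℕ)) :
    listDeg (p :: L) = (p.1.exponent * p.2) • wordDeg p.1.base + listDeg L := by
  simp [listDeg]

theorem exists_mem_homog_listDeg (L : List (Candidate Q × ℕ)) :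
    ∃ y ∈ homog K (listDeg L), toNichols Q y = (L.map fun p => p.1.elt ^ p.2).prod := by
  have hone : (1 : FreeAlgebra K (Fin 2)) ∈ homog K 0 := Submodule.subset_span ⟨[], rfl, rfl⟩
  have hpow : ∀ (a : Fin 2 → ℕ) (y : FreeAlgebra K (Fin 2)), y ∈ homog K a →
      ∀ e : ℕ, y ^ e ∈ homog K (e • a) := by
    intro a y hy e
    induction e with
    | zero => simpa using hone
    | succ e ih =>
      rw [pow_succ, succ_nsmul]
      exact mul_mem_homog ih hy
  induction L with
  | nil => exact ⟨1, by simpa [listDeg] using hone, by simp⟩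
  | cons p L ih =>
    obtain ⟨y, hy, hys⟩ := ih
    obtain ⟨z, hz, hzs⟩ := exists_mem_homog_superLetter Q p.1.base
    refine ⟨z ^ (p.1.exponent * p.2) * y, ?_, ?_⟩
    · rw [listDeg_cons]
      exact mul_mem_homog (hpow _ _ hz _) hy
    · rw [map_mul, map_pow, hzs, hys, List.map_cons, List.prod_cons, Candidate.elt, pow_mul]

theorem Candidate.count_one_base_pos {k l : ℕ} {c : Candidate Q} (hc : twoWord k l < c.word) :
    0 < c.base.count 1 := by
  refine Nat.pos_of_ne_zero fun h => ?_
  have hw : c.word.count 1 = 0 := by rw [Candidate.word, count_wordPow, h, mul_zero]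
  rw [eq_replicate_of_count_one hw] at hc
  exact not_twoWord_lt_replicate _ _ _ hc

theorem prod_eq_one_of_listDeg {k l : ℕ} (L : List (Candidate Q × ℕ))
    (hL : ∀ p ∈ L, twoWord k l < p.1.word) (hdeg : listDeg L 1 = 0) :
    (L.map fun p => p.1.elt ^ p.2).prod = 1 ∧ listDeg L 0 = 0 := by
  induction L with
  | nil => simp [listDeg]
  | cons p L ih =>
    have hc := Candidate.count_one_base_pos (hL p (by simp))
    have he := p.1.exponent_pos
    simp only [listDeg_cons, Pi.add_apply, Pi.smul_apply, smul_eq_mul, wordDeg] at hdeg ⊢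
    have hp : p.2 = 0 := by
      by_contra hne
      have := Nat.mul_pos (Nat.mul_pos he (Nat.pos_of_ne_zero hne)) hc
      omega
    obtain ⟨h1, h2⟩ := ih (fun p' hp' => hL p' (by simp [hp'])) (by omega)
    simp [h1, h2, hp]

theorem prod_eq_adPow_of_listDeg {k l : ℕ} (L : List (Candidate Q × ℕ))
    (hL : ∀ p ∈ L, twoWord k l < p.1.word) (hdeg : listDeg L 1 = 1) :
    listDeg L 0 < k ∧
      (L.map fun p => p.1.elt ^ p.2).prod = toNichols Q (adPow Q (listDeg L 0)) := by
  induction L with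
  | nil => simp [listDeg] at hdeg
  | cons p L ih =>
    have hp := hL p (by simp)
    have hL' : ∀ p ∈ L, twoWord k l < p.1.word := fun p' hp' => hL p' (by simp [hp'])
    simp only [listDeg_cons, Pi.add_apply, Pi.smul_apply, smul_eq_mul, wordDeg] at hdeg ⊢
    rw [List.map_cons, List.prod_cons]
    rcases Nat.eq_zero_or_pos (listDeg L 1) with h0 | h0
    · obtain ⟨h1, h2⟩ := prod_eq_one_of_listDeg L hL' h0
      rw [h0, add_zero] at hdeg
      have hcount := Nat.eq_one_of_mul_eq_one_left hdeg
      have hem := Nat.eq_one_of_mul_eq_one_right hdeg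
      have he := Nat.eq_one_of_mul_eq_one_right hem
      have hm := Nat.eq_one_of_mul_eq_one_left hem
      obtain ⟨a, ha⟩ := p.1.isLyndon.eq_oneWord hcount
      rw [Candidate.word, he, wordPow_one, ha, twoWord_lt_oneWord] at hp
      rw [h1, h2, Candidate.elt, he, hm, ha, superLetter_oneWord, count_zero_oneWord]
      simpa using hp
    · have hc := Candidate.count_one_base_pos hp
      have he := p.1.exponent_pos
      have hm : p.2 = 0 := by
        by_contra hne
        have := Nat.mul_pos (Nat.mul_pos he (Nat.pos_of_ne_zero hne)) hc
        omega
      have := ih hL' (by rw [hm] at hdeg; simpa using hdeg)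
      simpa [hm] using this

theorem prod_mem_midImage_of_listDeg {k l : ℕ} (L : List (Candidate Q × ℕ))
    (hL : ∀ p ∈ L, twoWord k l < p.1.word) (hdeg : listDeg L = ![k + l, 2]) :
    (L.map fun p => p.1.elt ^ p.2).prod ∈ midImage Q (k + l) (l + 1) := by
  have hdeg0 : listDeg L 0 = k + l := by rw [hdeg]; rfl
  have hdeg1 : listDeg L 1 = 2 := by rw [hdeg]; rfl
  clear hdeg
  induction L with
  | nil => simp [listDeg] at hdeg1
  | cons p L ih =>
    have hp := hL p (by simp)
    have hL' : ∀ p ∈ L, twoWord k l < p.1.word := fun p' hp' => hL p' (by simp [hp'])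
    have hc := Candidate.count_one_base_pos hp
    have he := p.1.exponent_pos
    simp only [listDeg_cons, Pi.add_apply, Pi.smul_apply, smul_eq_mul, wordDeg] at hdeg0 hdeg1
    rw [List.map_cons, List.prod_cons]
    have hL1 : listDeg L 1 = 0 ∨ listDeg L 1 = 1 ∨ listDeg L 1 = 2 := by omega
    rcases hL1 with h0 | h0 | h0
    · obtain ⟨h1, h2⟩ := prod_eq_one_of_listDeg L hL' h0
      rw [h0, add_zero] at hdeg1
      rw [h2, add_zero] at hdeg0
      rw [h1, mul_one, Candidate.elt, ← pow_mul]
      have hcases : p.1.exponent * p.2 = 1 ∧ p.1.base.count 1 = 2 ∨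
          p.1.exponent * p.2 = 2 ∧ p.1.base.count 1 = 1 := by
        have h3 : p.1.base.count 1 ≤ 2 := Nat.le_of_dvd two_pos (Dvd.intro_left _ hdeg1)
        have h4 : p.1.base.count 1 = 1 ∨ p.1.base.count 1 = 2 := by omega
        rcases h4 with h4 | h4 <;> rw [h4] at hdeg1 <;> omega
      rcases hcases with ⟨hem, hcount⟩ | ⟨hem, hcount⟩
      · obtain ⟨a, b, hba, hab⟩ := p.1.isLyndon.eq_twoWord hcount
        rw [hem, hab, count_zero_twoWord, one_mul] at hdeg0
        have he := Nat.eq_one_of_mul_eq_one_right hem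
        rw [Candidate.word, he, wordPow_one, hab, twoWord_lt_twoWord] at hp
        rw [hem, hab]
        obtain ⟨c, hcs, -, -, hs⟩ := exists_superLetter_twoWord Q hba
        rw [pow_one, hs, ← hdeg0]
        exact midImage_mono (by omega) (toNichols_quadSum_mem_midImage hcs)
      · obtain ⟨a, ha⟩ := p.1.isLyndon.eq_oneWord hcount
        rw [hem, ha, count_zero_oneWord] at hdeg0
        have hak : a < k := by
          have he' : p.1.exponent = 1 ∨ p.1.exponent = 2 := by
            have := Nat.le_of_dvd two_pos (Dvd.intro _ hem)
            omega
          rcases he' with he' | he'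
          · rwa [Candidate.word, he', wordPow_one, ha, twoWord_lt_oneWord] at hp
          · rw [Candidate.word, he', wordPow_two, ha, ← twoWord_eq_append,
              twoWord_lt_twoWord] at hp
            omega
        rw [hem, ha, superLetter_oneWord, sq, ← map_mul]
        exact toNichols_adPow_mul_mem_midImage (by omega) (by omega) (by omega)
    · obtain ⟨hlt, hprod⟩ := prod_eq_adPow_of_listDeg L hL' h0
      have h1 : p.1.exponent * p.2 * p.1.base.count 1 = 1 := by omega
      have hcount := Nat.eq_one_of_mul_eq_one_left h1
      have hem := Nat.eq_one_of_mul_eq_one_right h1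
      have he := Nat.eq_one_of_mul_eq_one_right hem
      have hm := Nat.eq_one_of_mul_eq_one_left hem
      obtain ⟨a, ha⟩ := p.1.isLyndon.eq_oneWord hcount
      rw [Candidate.word, he, wordPow_one, ha, twoWord_lt_oneWord] at hp
      rw [he, hm, ha, count_zero_oneWord] at hdeg0
      rw [hprod, Candidate.elt, he, hm, ha, superLetter_oneWord, pow_one, pow_one, ← map_mul]
      exact toNichols_adPow_mul_mem_midImage (by omega) (by omega) (by omega)
    · have hm : p.2 = 0 := by
        by_contra hne
        have := Nat.mul_pos (Nat.mul_pos he (Nat.pos_of_ne_zero hne)) hc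
        omega
      rw [hm, pow_zero, one_mul]
      rw [hm] at hdeg0
      exact ih hL' (by simpa using hdeg0) h0

/-- The homogeneous elements of degree `(k + l) α_1 + 2 α_2` in the span of the monomials in root
vector candidates larger than `x_1 ^ k x_2 x_1 ^ l x_2` are the linear combinations of the
products `u_a u_b` with `a, b > l`. -/
theorem toNichols_mem_span_largerMonomials_iff {k l : ℕ} {y : FreeAlgebra K (Fin 2)}
    (hy : y ∈ homog K ![k + l, 2]) :
    toNichols Q y ∈ Submodule.span K (largerMonomials Q (twoWord k l)) ↔
      toNichols Q y ∈ midImage Q (k + l) (l + 1) := by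
  refine ⟨fun h => ?_, fun h => midImage_le_span_largerMonomials k l h⟩
  -- It suffices to consider the components of degree `(k + l) α_1 + 2 α_2`.
  let S : Submodule K (FreeAlgebra K (Fin 2)) :=
    (midImage Q (k + l) (l + 1)).comap (toNicholsLin Q ∘ₗ degProj K (· = ![k + l, 2]))
  have hle : Submodule.span K (largerMonomials Q (twoWord k l)) ≤ S.map (toNicholsLin Q) := by
    rw [Submodule.span_le]
    rintro _ ⟨L, -, hL, rfl⟩
    obtain ⟨z, hz, hzs⟩ := exists_mem_homog_listDeg L
    refine ⟨z, ?_, hzs⟩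
    change toNichols Q (degProj K (· = ![k + l, 2]) z) ∈ midImage Q (k + l) (l + 1)
    by_cases hdeg : listDeg L = ![k + l, 2]
    · rw [degProj_of_mem_homog (hdeg ▸ hz), hzs]
      exact prod_mem_midImage_of_listDeg L hL hdeg
    · rw [degProj_of_mem_homog_of_ne hdeg hz, map_zero]
      exact zero_mem _
  obtain ⟨z, hz, hzy⟩ := hle h
  have hzy' : toNichols Q (z - y) = 0 := by
    rw [map_sub, sub_eq_zero]
    exact hzy
  have hproj := degProj_mem_radical (· = ![k + l, 2]) (toNichols_eq_zero_iff.1 hzy')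
  rw [← toNichols_eq_zero_iff, map_sub, map_sub, degProj_of_mem_homog hy, sub_eq_zero] at hproj
  rw [← hproj]
  exact hz

end LargerMonomials

/-! ### The criterion for root vectors -/

section RootVectors

variable {K : Type*} [Field K] {Q : Fin 2 → Fin 2 → K}

theorem toNichols_quadSum_mem_midImage_iff {k l : ℕ}
    (hβ : ∀ i < k + l, lowCoeff (Q 0 0) (Q 0 1 * Q 1 0) (i + 1) ≠ 0) {c : ℕ → K}
    (hc : c ∈ midSupp K (k + l) l) (hck : c k = 1)
    (hcl : l ≠ k → c l = -(Q 0 0 ^ (k * l) * Q 0 1 ^ k * Q 1 0 ^ l * Q 1 1)) :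
    toNichols Q (quadSum Q (k + l) c) ∈ midImage Q (k + l) (l + 1) ↔
      HasLeading (Q 0 0) (Q 0 1) (Q 1 0) (Q 1 1) (k + l) l := by
  have hmid : midSupp K (k + l) l ≤ suppLE K (k + l) := fun d hd a ha => hd a (by omega)
  constructor
  · rintro ⟨d, hd, hdc⟩
    have hds : d ∈ midSupp K (k + l) l := fun a ha => hd a (by omega)
    refine ⟨c - d, ?_, sub_mem hc hds, by omega, ?_⟩
    · rw [← quadSum_mem_radical_iff hβ (hmid (sub_mem hc hds)), ← toNichols_eq_zero_iff, map_sub,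
        map_sub, sub_eq_zero]
      exact hdc.symm
    · rw [Nat.add_sub_cancel, Pi.sub_apply, hck, hd k (by omega), sub_zero]
      exact one_ne_zero
  · rintro ⟨e, he, hes, -, htop⟩
    rw [Nat.add_sub_cancel] at htop
    -- The relation is normalized such that the coefficients of `u_k u_l` agree.
    have he' := Submodule.smul_mem _ (e k)⁻¹ he
    have hes' := Submodule.smul_mem _ (e k)⁻¹ hes
    have hek : ((e k)⁻¹ • e) k = 1 := inv_mul_cancel₀ htop
    generalize (e k)⁻¹ • e = e' at he' hes' hek
    have hel := coeff_of_mem_relSpace_of_mem_midSupp k l (fun i hi => hβ i (by omega)) he' hes'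
    have hsub : c - e' ∈ midSupp K (k + l) (l + 1) := by
      intro a ha
      rw [Pi.sub_apply]
      by_cases hak : a = k
      · rw [hak, hck, hek, sub_self]
      · by_cases hal : a = l
        · rw [hek, mul_one] at hel
          rw [hal, hcl (by omega), eq_neg_of_add_eq_zero_left hel, sub_self]
        · rw [hc a (by omega), hes' a (by omega), sub_self]
    have hzero := toNichols_eq_zero_iff.2 ((quadSum_mem_radical_iff hβ (hmid hes')).2 he')
    have := toNichols_quadSum_mem_midImage (Q := Q) hsub
    rwa [map_sub, map_sub, hzero, sub_zero] at this

/-- The word `x_1 ^ k x_2 x_1 ^ l x_2` is the word of a root vector candidate, and the element of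
every such candidate is, up to products `u_a u_b` with `l < a, b < k`, the braided commutator of
`u_k` and `u_l` if `l < k`, and the square of `u_k` if `l = k`. -/
theorem exists_candidate_elt_eq [CharZero K] {k l : ℕ} (hkl : l ≤ k)
    (hdiag : k = l → Q 0 0 ^ k ^ 2 * (Q 0 1 * Q 1 0) ^ k * Q 1 1 = -1) :
    ∃ c ∈ midSupp K (k + l) l, c k = 1 ∧
      (l ≠ k → c l = -(Q 0 0 ^ (k * l) * Q 0 1 ^ k * Q 1 0 ^ l * Q 1 1)) ∧
      (∃ C : Candidate Q, C.word = twoWord k l) ∧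
      ∀ C : Candidate Q, C.word = twoWord k l → C.elt = toNichols Q (quadSum Q (k + l) c) := by
  have hcand : ∀ C : Candidate Q, C.word = twoWord k l →
      (C.exponent = 1 ∧ C.base = twoWord k l ∧ l < k) ∨
        (C.exponent = 2 ∧ C.base = oneWord k ∧ l = k) := by
    intro C hC
    have hcount : C.exponent * C.base.count 1 = 2 := by
      rw [← count_wordPow, ← Candidate.word, hC, count_one_twoWord]
    have he : C.exponent = 1 ∨ C.exponent = 2 := by
      have h1 := Nat.le_of_dvd two_pos (Dvd.intro _ hcount)
      have h2 := C.exponent_pos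
      omega
    rcases he with he | he
    · rw [Candidate.word, he, wordPow_one] at hC
      refine Or.inl ⟨he, hC, lt_of_le_of_ne hkl ?_⟩
      rintro rfl
      exact not_isLyndon_twoWord_self l (hC ▸ C.isLyndon)
    · obtain ⟨a, ha⟩ := C.isLyndon.eq_oneWord (by rw [he] at hcount; omega)
      rw [Candidate.word, he, wordPow_two, ha, ← twoWord_eq_append] at hC
      have h1 : ¬ twoWord a a < twoWord k l := by rw [hC]; exact lt_irrefl _
      have h2 : ¬ twoWord k l < twoWord a a := by rw [hC]; exact lt_irrefl _
      rw [twoWord_lt_twoWord] at h1 h2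
      have hak : a = k := by omega
      exact Or.inr ⟨he, by rw [ha, hak], by omega⟩
  rcases hkl.lt_or_eq with h | rfl
  · obtain ⟨c, hc, hck, hcl, hs⟩ := exists_superLetter_twoWord Q h
    refine ⟨c, hc, hck, fun _ => hcl, ⟨lyndonCandidate Q (isLyndon_twoWord h),
      lyndonCandidate_word _⟩, fun C hC => ?_⟩
    rcases hcand C hC with ⟨he, hb, -⟩ | ⟨-, -, h'⟩
    · rw [Candidate.elt, he, hb, pow_one, hs]
    · omega
  · refine ⟨Pi.single l 1, ?_, by simp, fun h => absurd rfl h, ?_, fun C hC => ?_⟩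
    · intro a ha
      have : a ≠ l := by omega
      simp [this]
    · have hχ : bichar Q (wordDeg (oneWord l)) (wordDeg (oneWord l)) = -1 := by
        rw [bichar_wordDeg, count_zero_oneWord, count_one_oneWord, ← hdiag rfl, mul_pow]
        ring
      have horder : orderOf (bichar Q (wordDeg (oneWord l)) (wordDeg (oneWord l))) = 2 := by
        rw [hχ]
        have : Fact (Nat.Prime 2) := ⟨Nat.prime_two⟩
        exact orderOf_eq_prime (by norm_num) (by norm_num)
      refine ⟨⟨oneWord l, 2, isLyndon_oneWord l, Or.inr ⟨by omega, 0, by rw [horder, pow_zero, mul_one]⟩⟩, ?_⟩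
      rw [Candidate.word, wordPow_two, ← twoWord_eq_append]
    · rcases hcand C hC with ⟨-, -, h'⟩ | ⟨he, hb, -⟩
      · omega
      · rw [Candidate.elt, he, hb, superLetter_oneWord, sq, ← map_mul, quadSum_single]

end RootVectors

end RootVec

end

theorem corollary4p18 {K : Type*} [Field K] [CharZero K]
    (Q : Fin 2 → Fin 2 → K) (hQ : ∀ i j, Q i j ≠ 0) (q r s : K)
    (hq : q = Q 0 0) (hr : r = Q 0 1 * Q 1 0) (hs : s = Q 1 1)
    (k l : ℕ) (hkl : l ≤ k)
    (hb : RootVec.qFactorial q (k + l) * RootVec.bProd q r (k + l) ≠ 0)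
    (hdiag : k = l → q ^ k ^ 2 * r ^ k * s = -1) :
    RootVec.IsRootVector Q (List.replicate k 0 ++ [1] ++ List.replicate l 0 ++ [1]) ↔
      (RootVec.setJ q r s ∩ Set.Icc 0 (k + l)).ncard ≤ l := by
  subst hq hr hs
  have hβ : ∀ i < k + l, RootVec.lowCoeff (Q 0 0) (Q 0 1 * Q 1 0) (i + 1) ≠ 0 := by
    intro i hi
    rw [RootVec.lowCoeff_succ]
    exact mul_ne_zero
      (Finset.prod_ne_zero_iff.1 (left_ne_zero_of_mul hb) i (Finset.mem_range.2 hi))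
      (Finset.prod_ne_zero_iff.1 (right_ne_zero_of_mul hb) i (Finset.mem_range.2 hi))
  have hword : List.replicate k (0 : Fin 2) ++ [1] ++ List.replicate l 0 ++ [1] =
      RootVec.twoWord k l := by
    simp [RootVec.twoWord, RootVec.oneWord]
  obtain ⟨c, hc, hck, hcl, ⟨C, hC⟩, helt⟩ := RootVec.exists_candidate_elt_eq hkl hdiag
  have hroot : RootVec.IsRootVector Q (RootVec.twoWord k l) ↔
      ¬ RootVec.HasLeading (Q 0 0) (Q 0 1) (Q 1 0) (Q 1 1) (k + l) l := by
    rw [← RootVec.toNichols_quadSum_mem_midImage_iff hβ hc hck hcl,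
      ← RootVec.toNichols_mem_span_largerMonomials_iff (RootVec.quadSum_mem_homog _ _)]
    constructor
    · rintro ⟨C', hC', h⟩
      rwa [helt C' hC'] at h
    · exact fun h => ⟨C, hC, by rwa [helt C hC]⟩
  rw [hword, hroot, RootVec.hasLeading_iff (hQ 0 0) (hQ 1 0) hβ l,
    (RootVec.relSpace_le_span_relGens_and_finrank (hQ 0 0) (hQ 0 1) (k + l) hβ).2, not_lt]
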